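/- A $(\chi_d,\Delta^*)$-coloring of a finite simple graph $G=(V,E)$, for integers $\chi_d\ge 1$ and $\Delta^*\ge 0$, is a partition of $V$ into $\chi_d$ (possibly empty) sets, each of which induces a graph of maximum degree at most $\Delta^*$. A feedback vertex set of $G$ is a set of vertices whose removal leaves an acyclic graph. There is an algorithm which, given an $n$-vertex graph $G$, integers $\chi_d\ge 1$ and $\Delta^*\ge 0$, and a feedback vertex set of $G$ of size $\mathrm{fvs}$, either returns a $(\chi_d+1,\Delta^*)$-coloring of $G$ or correctly concludes that $G$ does not admit a $(\chi_d,\Delta^*)$-coloring, in time $\mathrm{fvs}^{O(\mathrm{fvs})}n^{O(1)}$. That is, there are a single program for a unit-cost random access machine (with addition and truncated subtraction as its arithmetic operations) and a constant $c$ such that on every such input the program halts with a correct answer after at most $c\cdot \mathrm{fvs}^{c\cdot\mathrm{fvs}}(n+1)^{c}$ steps, where $0^0=1$. -/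

import Mathlib

/-! ### Defective colorings and feedback vertex sets -/

open Classical in
/-- `f` partitions the vertices into `χ` (possibly empty) color classes, each of which induces
a graph of maximum degree at most `Δ`. -/
def IsDefectiveColoring {V : Type*} [Fintype V] (G : SimpleGraph V) {χ : ℕ} (Δ : ℕ)
    (f : V → Fin χ) : Prop :=
  ∀ i : Fin χ, (G.induce {v | f v = i}).maxDegree ≤ Δ

/-- `G` admits a `(χ, Δ)`-coloring. -/
def AdmitsDefectiveColoring {V : Type*} [Fintype V] (G : SimpleGraph V) (χ Δ : ℕ) : Prop :=
  ∃ f : V → Fin χ, IsDefectiveColoring G Δ f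

/-- Removing the vertices of `S` leaves an acyclic graph. -/
def IsFeedbackVertexSet {V : Type*} (G : SimpleGraph V) (S : Finset V) : Prop :=
  (G.induce {v | v ∉ S}).IsAcyclic

/-! ### The machine model

A random access machine with unit cost, programmed by structured programs.  Its memory consists of
arrays of natural numbers; a program addresses the arrays by fixed names, so that it
uses finitely many of them, and their cells by computed indices.  The arithmetic operations are
addition and truncated subtraction only, so that unit cost is a fair measure (polynomially
related to the running time of Turing machines). -/

namespace RAM

/-- The memory: cell `i` of array `a` holds the number `σ a i`. -/
abbrev Store : Type := ℕ → ℕ → ℕ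

/-- Arithmetic expressions. -/
inductive Expr : Type
  /-- a literal -/
  | lit (k : ℕ) : Expr
  /-- the content of the cell of array `a` whose index is the value of `i` -/
  | cell (a : ℕ) (i : Expr) : Expr
  /-- addition -/
  | plus (e₁ e₂ : Expr) : Expr
  /-- truncated subtraction -/
  | minus (e₁ e₂ : Expr) : Expr

/-- The value of an expression in a memory. -/
def Expr.eval (σ : Store) : Expr → ℕ
  | .lit k => k
  | .cell a i => σ a (i.eval σ)
  | .plus e₁ e₂ => e₁.eval σ + e₂.eval σ
  | .minus e₁ e₂ => e₁.eval σ - e₂.eval σ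

/-- The number of operations made to evaluate an expression. -/
def Expr.cost : Expr → ℕ
  | .lit _ => 1
  | .cell _ i => i.cost + 1
  | .plus e₁ e₂ => e₁.cost + e₂.cost + 1
  | .minus e₁ e₂ => e₁.cost + e₂.cost + 1

/-- Programs. -/
inductive Prog : Type
  /-- do nothing -/
  | nop : Prog
  /-- write the value of `e` to the cell of array `a` whose index is the value of `i` -/
  | store (a : ℕ) (i e : Expr) : Prog
  /-- run `p`, then `q` -/
  | seq (p q : Prog) : Prog
  /-- run `p` if the value of `b` is nonzero, and `q` otherwise -/
  | branch (b : Expr) (p q : Prog) : Prog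
  /-- run `p` again and again as long as the value of `b` is nonzero -/
  | loop (b : Expr) (p : Prog) : Prog

/-- The memory `σ` after the number `v` has been written to cell `i` of array `a`. -/
def Store.write (σ : Store) (a i v : ℕ) : Store :=
  Function.update σ a (Function.update (σ a) i v)

/-- `Run p σ t τ`: started in the memory `σ`, the program `p` halts after exactly `t` steps,
and then the memory is `τ`. -/
inductive Run : Prog → Store → ℕ → Store → Prop
  | nop (σ : Store) : Run .nop σ 1 σ
  | store (a : ℕ) (i e : Expr) (σ : Store) :
      Run (.store a i e) σ (i.cost + e.cost + 1) (σ.write a (i.eval σ) (e.eval σ))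
  | seq {p q : Prog} {σ τ υ : Store} {s t : ℕ} :
      Run p σ s τ → Run q τ t υ → Run (.seq p q) σ (s + t) υ
  | branchTrue {b : Expr} {p q : Prog} {σ τ : Store} {t : ℕ} :
      b.eval σ ≠ 0 → Run p σ t τ → Run (.branch b p q) σ (b.cost + 1 + t) τ
  | branchFalse {b : Expr} {p q : Prog} {σ τ : Store} {t : ℕ} :
      b.eval σ = 0 → Run q σ t τ → Run (.branch b p q) σ (b.cost + 1 + t) τ
  | loopStop {b : Expr} {p : Prog} {σ : Store} :
      b.eval σ = 0 → Run (.loop b p) σ (b.cost + 1) σ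
  | loopStep {b : Expr} {p : Prog} {σ τ υ : Store} {s t : ℕ} :
      b.eval σ ≠ 0 → Run p σ s τ → Run (.loop b p) τ t υ →
        Run (.loop b p) σ (b.cost + 1 + s + t) υ

/-- The machine is deterministic: running time and final memory are unique. -/
theorem Run.deterministic {p : Prog} {σ τ τ' : Store} {t t' : ℕ}
    (h : Run p σ t τ) (h' : Run p σ t' τ') : t = t' ∧ τ = τ' := by
  induction h generalizing t' τ' with
  | nop => cases h'; exact ⟨rfl, rfl⟩
  | store => cases h'; exact ⟨rfl, rfl⟩
  | seq _ _ ih₁ ih₂ =>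
    cases h' with
    | seq k₁ k₂ =>
      obtain ⟨rfl, rfl⟩ := ih₁ k₁
      obtain ⟨rfl, rfl⟩ := ih₂ k₂
      exact ⟨rfl, rfl⟩
  | branchTrue hb _ ih =>
    cases h' with
    | branchTrue _ k => obtain ⟨rfl, rfl⟩ := ih k; exact ⟨rfl, rfl⟩
    | branchFalse hc _ => exact absurd hc hb
  | branchFalse hb _ ih =>
    cases h' with
    | branchTrue hc _ => exact absurd hb hc
    | branchFalse _ k => obtain ⟨rfl, rfl⟩ := ih k; exact ⟨rfl, rfl⟩
  | loopStop hb =>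
    cases h' with
    | loopStop _ => exact ⟨rfl, rfl⟩
    | loopStep hc _ _ => exact absurd hb hc
  | loopStep hb _ _ ih₁ ih₂ =>
    cases h' with
    | loopStop hc => exact absurd hc hb
    | loopStep _ k₁ k₂ =>
      obtain ⟨rfl, rfl⟩ := ih₁ k₁
      obtain ⟨rfl, rfl⟩ := ih₂ k₂
      exact ⟨rfl, rfl⟩

end RAM

/-! ### Input and output -/

open Classical in
/-- The initial memory for the instance `(G, χ, Δ, S)`, where `G` has the vertices `0, …, n - 1`.
Array 0 starts with the numbers `n`, `χ`, `Δ`; array 1 is the adjacency matrix of `G`, row by row;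
array 2 is the indicator vector of `S`; all the other cells are 0. -/
noncomputable def inputStore {n : ℕ} (G : SimpleGraph (Fin n)) (χ Δ : ℕ) (S : Finset (Fin n)) :
    RAM.Store
  | 0, 0 => n
  | 0, 1 => χ
  | 0, 2 => Δ
  | 1, p => if ∃ u v : Fin n, G.Adj u v ∧ p = (u : ℕ) * n + v then 1 else 0
  | 2, p => if ∃ v ∈ S, p = (v : ℕ) then 1 else 0
  | _, _ => 0

/-- The final memory returns the coloring `f`: cell 0 of array 3 is 1, and array 4 lists the
colors of the vertices `0, …, n - 1`. -/
def ReturnsColoring {n χ : ℕ} (τ : RAM.Store) (f : Fin n → Fin χ) : Prop :=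
  τ 3 0 = 1 ∧ ∀ v : Fin n, τ 4 v = f v

/-- The final memory reports that there is no coloring: cell 0 of array 3 is 0. -/
def ReportsNone (τ : RAM.Store) : Prop :=
  τ 3 0 = 0

/-! ### Polynomially bounded functions -/

/-! Let k be the size of the feedback vertex set S. A forest is 2-colorable, so k + 2 colors always
suffice, and only b = min(χ, k + 2) colors are tried. Suppose that a coloring g with b colors and
defect at most Δ exists. It is enough to know g on S and on at most k further vertices. These 2k
colors are enumerated as the base-b digits of a counter, and b^(2k) ≤ 9·k^(4k).

Given g on S, order the forest so that each vertex has at most one later neighbor, its parent. A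
forest vertex is full if all b colors occur among its neighbors in S. From the leaves upwards, a
vertex is forced if it is full or has a guessed child. It becomes guessed (status 2) if its children
of status 1, plus one if it is itself forced, number more than Δ; otherwise its status is 1 if it is
forced and 0 if not. Guessed vertices keep their color from g. From the roots downwards, every
vertex of status 1 takes the extra color b, and so does every vertex of status 0 whose parent lacks
it. The remaining vertices take a color unused among their neighbors in S. Then conflicts occur only
among vertices colored by g, where the defect of g bounds them, or among vertices of the extra
color, where the threshold Δ bounds them (`card_color_le`).

At most k vertices are guessed. Double counting parents and children gives Δ·#guessed ≤ #full
(`card_status_two`). Each full vertex shares its color under g with a neighbor in S, so #full ≤ k·Δ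
(`card_full`).

The program tests each coloring it produces, so a positive answer needs no further argument; the
combinatorics is needed only to justify a negative one (`exists_goodGuess`). The running time comes
from a small language whose loops all have length a fixed multiple of n: its compiled programs take
polynomial time (`Cmd.exists_run_compile`), and the only unrestricted loop is the one over the
guesses. -/

/-- `f` is bounded by a polynomial. -/
def PolyBounded (f : ℕ → ℕ) : Prop :=
  ∃ C D : ℕ, ∀ n, f n ≤ C * (n + 1) ^ D

namespace PolyBounded

theorem const (k : ℕ) : PolyBounded fun _ => k := ⟨k, 0, fun n => by simp⟩

theorem id : PolyBounded fun n => n := ⟨1, 1, fun n => by simp⟩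

theorem add {f g : ℕ → ℕ} (hf : PolyBounded f) (hg : PolyBounded g) :
    PolyBounded fun n => f n + g n := by
  obtain ⟨C, D, hf⟩ := hf
  obtain ⟨C', D', hg⟩ := hg
  refine ⟨C + C', D + D', fun n => ?_⟩
  have h₁ : (n + 1) ^ D ≤ (n + 1) ^ (D + D') := Nat.pow_le_pow_right (by omega) (by omega)
  have h₂ : (n + 1) ^ D' ≤ (n + 1) ^ (D + D') := Nat.pow_le_pow_right (by omega) (by omega)
  calc f n + g n ≤ C * (n + 1) ^ D + C' * (n + 1) ^ D' := Nat.add_le_add (hf n) (hg n)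
    _ ≤ C * (n + 1) ^ (D + D') + C' * (n + 1) ^ (D + D') := by gcongr
    _ = _ := by ring

theorem mul {f g : ℕ → ℕ} (hf : PolyBounded f) (hg : PolyBounded g) :
    PolyBounded fun n => f n * g n := by
  obtain ⟨C, D, hf⟩ := hf
  obtain ⟨C', D', hg⟩ := hg
  refine ⟨C * C', D + D', fun n => ?_⟩
  calc f n * g n ≤ (C * (n + 1) ^ D) * (C' * (n + 1) ^ D') := Nat.mul_le_mul (hf n) (hg n)
    _ = _ := by ring

end PolyBounded

/-! ### A language of programs that halt in polynomial time -/

namespace RAM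

open Function

/-- A loop halts if every run of its body uses up one unit of a budget. -/
theorem Run.loop_of_budget {b : Expr} {p : Prog} {I : ℕ → Store → Prop} {T : ℕ}
    (h : ∀ i σ, I i σ → b.eval σ ≠ 0 →
      ∃ j, i = j + 1 ∧ ∃ t τ, Run p σ t τ ∧ t ≤ T ∧ I j τ)
    (i : ℕ) (σ : Store) (hI : I i σ) :
    ∃ t τ, Run (.loop b p) σ t τ ∧ t ≤ (i + 1) * (b.cost + 1 + T) ∧
      (∃ j ≤ i, I j τ) ∧ b.eval τ = 0 := by
  induction i generalizing σ with
  | zero =>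
    by_cases hb : b.eval σ = 0
    · exact ⟨_, σ, .loopStop hb, by omega, ⟨0, le_rfl, hI⟩, hb⟩
    · obtain ⟨j, hj, -⟩ := h 0 σ hI hb
      omega
  | succ i ih =>
    by_cases hb : b.eval σ = 0
    · refine ⟨_, σ, .loopStop hb, ?_, ⟨i + 1, le_rfl, hI⟩, hb⟩
      rw [add_mul]
      omega
    · obtain ⟨j, hj, t, τ, hr, ht, hI'⟩ := h _ σ hI hb
      obtain rfl : i = j := by omega
      obtain ⟨t', τ', hr', ht', ⟨j, hj, hI''⟩, hb'⟩ := ih τ hI'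
      refine ⟨_, τ', .loopStep hb hr hr', ?_, ⟨j, by omega, hI''⟩, hb'⟩
      rw [add_mul (i + 1)]
      omega

/-- Arithmetic terms with variables, case distinction, and summation over a range whose length
is a fixed multiple of the number in cell 0 of array 0. -/
inductive Term : Type
  /-- a literal -/
  | lit (k : ℕ) : Term
  /-- a variable -/
  | var (x : ℕ) : Term
  /-- the content of a cell -/
  | cell (a : ℕ) (i : Term) : Term
  /-- addition -/
  | plus (e₁ e₂ : Term) : Term
  /-- truncated subtraction -/
  | minus (e₁ e₂ : Term) : Term
  /-- `e₁` if `b` is nonzero, and `e₂` otherwise -/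
  | ite (b e₁ e₂ : Term) : Term
  /-- the sum of the values of `e` where `x` runs through the numbers below `m * n` -/
  | sum (x m : ℕ) (e : Term) : Term

/-- The value of a term. -/
def Term.eval (σ : Store) : Term → (ℕ → ℕ) → ℕ
  | .lit k, _ => k
  | .var x, ρ => ρ x
  | .cell a i, ρ => σ a (i.eval σ ρ)
  | .plus e₁ e₂, ρ => e₁.eval σ ρ + e₂.eval σ ρ
  | .minus e₁ e₂, ρ => e₁.eval σ ρ - e₂.eval σ ρ
  | .ite b e₁ e₂, ρ => if b.eval σ ρ ≠ 0 then e₁.eval σ ρ else e₂.eval σ ρ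
  | .sum x m e, ρ => ∑ i ∈ Finset.range (m * σ 0 0), e.eval σ (update ρ x i)

/-- A number above all the arrays that a term reads. -/
def Term.arrays : Term → ℕ
  | .lit _ => 0
  | .var _ => 0
  | .cell a i => max (a + 1) i.arrays
  | .plus e₁ e₂ => max e₁.arrays e₂.arrays
  | .minus e₁ e₂ => max e₁.arrays e₂.arrays
  | .ite b e₁ e₂ => max b.arrays (max e₁.arrays e₂.arrays)
  | .sum _ _ e => max 1 e.arrays

/-- The expression `m * n`. -/
def Expr.mulSize : ℕ → Expr
  | 0 => .lit 0
  | m + 1 => .plus (mulSize m) (.cell 0 (.lit 0))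

@[simp] theorem Expr.eval_mulSize (σ : Store) (m : ℕ) : (mulSize m).eval σ = m * σ 0 0 := by
  induction m with
  | zero => simp [mulSize, eval]
  | succ m ih => simp [mulSize, eval, ih, add_mul]

/-- Register `r`, in the array `R`. -/
abbrev Expr.reg (R r : ℕ) : Expr := .cell R (.lit r)

/-- The command that sets register `r`. -/
abbrev Prog.setReg (R r : ℕ) (e : Expr) : Prog := .store R (.lit r) e

/-- The program that leaves the value of a term in register `r`, using the registers from `r` on;
the value of the variable `x` is expected in register `κ x`. -/
def Term.compile (R : ℕ) : Term → (ℕ → ℕ) → ℕ → Prog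
  | .lit k, _, r => .setReg R r (.lit k)
  | .var x, κ, r => .setReg R r (.reg R (κ x))
  | .cell a i, κ, r => .seq (i.compile R κ r) (.setReg R r (.cell a (.reg R r)))
  | .plus e₁ e₂, κ, r => .seq (.seq (e₁.compile R κ r) (e₂.compile R κ (r + 1)))
      (.setReg R r (.plus (.reg R r) (.reg R (r + 1))))
  | .minus e₁ e₂, κ, r => .seq (.seq (e₁.compile R κ r) (e₂.compile R κ (r + 1)))
      (.setReg R r (.minus (.reg R r) (.reg R (r + 1))))
  | .ite b e₁ e₂, κ, r => .seq (b.compile R κ r)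
      (.branch (.reg R r) (e₁.compile R κ r) (e₂.compile R κ r))
  | .sum x m e, κ, r => .seq (.seq (.setReg R r (.lit 0)) (.setReg R (r + 1) (.lit 0)))
      (.loop (.minus (.mulSize m) (.reg R (r + 1)))
        (.seq (e.compile R (update κ x (r + 1)) (r + 2))
          (.seq (.setReg R r (.plus (.reg R r) (.reg R (r + 2))))
            (.setReg R (r + 1) (.plus (.reg R (r + 1)) (.lit 1))))))

/-- The memories have the same arrays below `R`. -/
def AgreeBelow (R : ℕ) (σ τ : Store) : Prop := ∀ a < R, τ a = σ a

theorem Store.write_apply (σ : Store) (a i v b j : ℕ) :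
    σ.write a i v b j = if b = a ∧ j = i then v else σ b j := by
  unfold Store.write
  by_cases h : b = a
  · subst h
    by_cases h' : j = i <;> simp [h']
  · simp [h]

theorem Store.write_of_ne (σ : Store) {a b : ℕ} (i v : ℕ) (h : b ≠ a) :
    σ.write a i v b = σ b := by
  simp [Store.write, h]

theorem AgreeBelow.write_reg {R : ℕ} {σ τ : Store} (h : AgreeBelow R σ τ) (i v : ℕ) :
    AgreeBelow R σ (τ.write R i v) := fun a ha => by
  rw [Store.write_of_ne _ _ _ ha.ne, h a ha]

/-- What a compiled term does. -/
def Term.CompileSpec (R : ℕ) (e : Term) (κ : ℕ → ℕ) (r : ℕ) (T : ℕ → ℕ) : Prop :=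
  ∀ (σ σ' : Store) (ρ : ℕ → ℕ), AgreeBelow R σ σ' → (∀ x, σ' R (κ x) = ρ x) →
    ∃ t τ, Run (e.compile R κ r) σ' t τ ∧ t ≤ T (σ 0 0) ∧ AgreeBelow R σ τ ∧
      (∀ i < r, τ R i = σ' R i) ∧ τ R r = e.eval σ ρ

/-- The first value survives in register `r` because the second computation starts at `r + 1` and
preserves everything below. -/
theorem Term.compileSpec_binary {R : ℕ} {e₁ e₂ : Term} {κ : ℕ → ℕ} {r : ℕ} {T₁ T₂ : ℕ → ℕ}
    (hκ : ∀ x, κ x < r) (h₁ : e₁.CompileSpec R κ r T₁) (h₂ : e₂.CompileSpec R κ (r + 1) T₂)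
    (σ σ' : Store) (ρ : ℕ → ℕ) (hσ : AgreeBelow R σ σ') (hρ : ∀ x, σ' R (κ x) = ρ x) :
    ∃ t τ, Run (.seq (e₁.compile R κ r) (e₂.compile R κ (r + 1))) σ' t τ ∧
      t ≤ T₁ (σ 0 0) + T₂ (σ 0 0) ∧ AgreeBelow R σ τ ∧ (∀ i < r, τ R i = σ' R i) ∧
      τ R r = e₁.eval σ ρ ∧ τ R (r + 1) = e₂.eval σ ρ := by
  obtain ⟨t, τ, hr, ht, hA, hreg, hv⟩ := h₁ σ σ' ρ hσ hρ
  obtain ⟨t', τ', hr', ht', hA', hreg', hv'⟩ :=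
    h₂ σ τ ρ hA (fun x => by rw [hreg _ (hκ x), hρ])
  refine ⟨_, τ', .seq hr hr', by omega, hA', fun i hi => ?_, ?_, hv'⟩
  · rw [hreg' i (by omega), hreg i hi]
  · rw [hreg' r (by omega), hv]

/-- Induction on the term. Registers live in array `R`, above every array that the term reads, so
scratch work never disturbs the data. Nested sums multiply the time by factors m·n + 1, which keeps
it polynomial in n, uniformly in the store. -/
theorem Term.exists_compileSpec (R : ℕ) (e : Term) (κ : ℕ → ℕ) (r : ℕ) (hR : e.arrays ≤ R)
    (hκ : ∀ x, κ x < r) : ∃ T, PolyBounded T ∧ e.CompileSpec R κ r T := by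
  induction e generalizing κ r with
  | lit k =>
    refine ⟨fun _ => _, .const _, fun σ σ' ρ hσ hρ => ⟨_, _, .store _ _ _ _, le_rfl,
      hσ.write_reg _ _, fun i hi => ?_, ?_⟩⟩
    · simp [Store.write_apply, Expr.eval, hi.ne]
    · simp [Store.write_apply, Expr.eval, eval]
  | var x =>
    refine ⟨fun _ => _, .const _, fun σ σ' ρ hσ hρ => ⟨_, _, .store _ _ _ _, le_rfl,
      hσ.write_reg _ _, fun i hi => ?_, ?_⟩⟩
    · simp [Store.write_apply, Expr.eval, hi.ne]
    · simp [Store.write_apply, Expr.eval, eval, hρ]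
  | cell a i ih =>
    simp only [arrays, max_le_iff] at hR
    obtain ⟨T, hT, h⟩ := ih κ r hR.2 hκ
    refine ⟨fun n => T n + ((Expr.lit r).cost + (Expr.cell a (.reg R r)).cost + 1),
      hT.add (.const _), fun σ σ' ρ hσ hρ => ?_⟩
    obtain ⟨t, τ, hr, ht, hA, hreg, hv⟩ := h σ σ' ρ hσ hρ
    refine ⟨_, _, .seq hr (.store _ _ _ _), Nat.add_le_add_right ht _,
      hA.write_reg _ _, fun i hi => ?_, ?_⟩
    · simp [Store.write_apply, Expr.eval, hi.ne, hreg i hi]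
    · simp [Store.write_apply, Expr.eval, eval, hv, hA a hR.1]
  | plus e₁ e₂ ih₁ ih₂ =>
    simp only [arrays, max_le_iff] at hR
    obtain ⟨T₁, hT₁, h₁⟩ := ih₁ κ r hR.1 hκ
    obtain ⟨T₂, hT₂, h₂⟩ := ih₂ κ (r + 1) hR.2 (fun x => (hκ x).trans (by omega))
    refine ⟨fun n => T₁ n + T₂ n + ((Expr.lit r).cost +
      (Expr.plus (.reg R r) (.reg R (r + 1))).cost + 1), (hT₁.add hT₂).add (.const _),
      fun σ σ' ρ hσ hρ => ?_⟩
    obtain ⟨t, τ, hr, ht, hA, hreg, hv, hv'⟩ := compileSpec_binary hκ h₁ h₂ σ σ' ρ hσ hρ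
    refine ⟨_, _, .seq hr (.store _ _ _ _), Nat.add_le_add_right ht _,
      hA.write_reg _ _, fun i hi => ?_, ?_⟩
    · simp [Store.write_apply, Expr.eval, hi.ne, hreg i hi]
    · simp [Store.write_apply, Expr.eval, eval, hv, hv']
  | minus e₁ e₂ ih₁ ih₂ =>
    simp only [arrays, max_le_iff] at hR
    obtain ⟨T₁, hT₁, h₁⟩ := ih₁ κ r hR.1 hκ
    obtain ⟨T₂, hT₂, h₂⟩ := ih₂ κ (r + 1) hR.2 (fun x => (hκ x).trans (by omega))
    refine ⟨fun n => T₁ n + T₂ n + ((Expr.lit r).cost +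
      (Expr.minus (.reg R r) (.reg R (r + 1))).cost + 1), (hT₁.add hT₂).add (.const _),
      fun σ σ' ρ hσ hρ => ?_⟩
    obtain ⟨t, τ, hr, ht, hA, hreg, hv, hv'⟩ := compileSpec_binary hκ h₁ h₂ σ σ' ρ hσ hρ
    refine ⟨_, _, .seq hr (.store _ _ _ _), Nat.add_le_add_right ht _,
      hA.write_reg _ _, fun i hi => ?_, ?_⟩
    · simp [Store.write_apply, Expr.eval, hi.ne, hreg i hi]
    · simp [Store.write_apply, Expr.eval, eval, hv, hv']
  | ite b e₁ e₂ ih ih₁ ih₂ =>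
    simp only [arrays, max_le_iff] at hR
    obtain ⟨T, hT, h⟩ := ih κ r hR.1 hκ
    obtain ⟨T₁, hT₁, h₁⟩ := ih₁ κ r hR.2.1 hκ
    obtain ⟨T₂, hT₂, h₂⟩ := ih₂ κ r hR.2.2 hκ
    refine ⟨fun n => T n + (((Expr.reg R r).cost + 1) + (T₁ n + T₂ n)),
      hT.add ((PolyBounded.const _).add (hT₁.add hT₂)), fun σ σ' ρ hσ hρ => ?_⟩
    obtain ⟨t, τ, hr, ht, hA, hreg, hv⟩ := h σ σ' ρ hσ hρ
    have hρ' : ∀ x, τ R (κ x) = ρ x := fun x => by rw [hreg _ (hκ x), hρ]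
    by_cases hb : b.eval σ ρ = 0
    · obtain ⟨t', τ', hr', ht', hA', hreg', hv'⟩ := h₂ σ τ ρ hA hρ'
      refine ⟨_, _, .seq hr (.branchFalse (by simpa [Expr.eval, hv]) hr'), by dsimp only; omega, hA',
        fun i hi => ?_, ?_⟩
      · rw [hreg' i hi, hreg i hi]
      · rw [hv', eval, if_neg (by simpa using hb)]
    · obtain ⟨t', τ', hr', ht', hA', hreg', hv'⟩ := h₁ σ τ ρ hA hρ'
      refine ⟨_, _, .seq hr (.branchTrue (by simpa [Expr.eval, hv]) hr'), by dsimp only; omega, hA',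
        fun i hi => ?_, ?_⟩
      · rw [hreg' i hi, hreg i hi]
      · rw [hv', eval, if_pos hb]
  | sum x m e ih =>
    simp only [arrays, max_le_iff] at hR
    -- Register `r` accumulates the sum, and `r + 1` is at once the loop counter and the home of the
    -- summation variable; the summand is computed from `r + 2` on.
    obtain ⟨T, hT, h⟩ := ih (update κ x (r + 1)) (r + 2) hR.2 (fun y => by
      by_cases hy : y = x
      · simp [hy]
      · simpa [hy] using (hκ y).trans (by omega))
    set bd : Expr := .minus (.mulSize m) (.reg R (r + 1)) with hbd
    -- A generous bound on the constant cost of the two register updates in the loop body.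
    let c : ℕ := 100
    refine ⟨fun n => 6 + (m * n + 1) * (bd.cost + 1 + (T n + c)),
      (PolyBounded.const _).add ((((PolyBounded.const m).mul .id).add (.const _)).mul
        ((PolyBounded.const _).add (hT.add (.const _)))), fun σ σ' ρ hσ hρ => ?_⟩
    set N := m * σ 0 0 with hN
    -- The budget `j` is the number of iterations still to come, so the counter stands at `N - j`.
    let I : ℕ → Store → Prop := fun j τ => j ≤ N ∧ AgreeBelow R σ τ ∧
      (∀ i < r, τ R i = σ' R i) ∧ τ R (r + 1) = N - j ∧
      τ R r = ∑ i ∈ Finset.range (N - j), e.eval σ (update ρ x i)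
    have hbody : ∀ j τ, I j τ → bd.eval τ ≠ 0 → ∃ j', j = j' + 1 ∧ ∃ t τ',
        Run (.seq (e.compile R (update κ x (r + 1)) (r + 2))
          (.seq (.setReg R r (.plus (.reg R r) (.reg R (r + 2))))
            (.setReg R (r + 1) (.plus (.reg R (r + 1)) (.lit 1))))) τ t τ' ∧
          t ≤ T (σ 0 0) + c ∧ I j' τ' := by
      rintro j τ ⟨hj, hA, hreg, hctr, hsum⟩ hb
      have hj0 : j ≠ 0 := by
        rintro rfl
        apply hb
        simp [hbd, Expr.eval, hctr, hN, hA 0 (by omega)]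
      obtain ⟨j', rfl⟩ := Nat.exists_eq_succ_of_ne_zero hj0
      obtain ⟨t, τ', hr, ht, hA', hreg', hv⟩ := h σ τ (update ρ x (N - (j' + 1))) hA (fun y => by
        by_cases hy : y = x
        · subst hy
          simp [hctr]
        · simp [hy, hreg _ (hκ y), hρ])
      refine ⟨j', rfl, _, _, .seq hr (.seq (.store _ _ _ _) (.store _ _ _ _)),
        Nat.add_le_add ht ?_, by omega, (hA'.write_reg _ _).write_reg _ _, fun i hi => ?_, ?_, ?_⟩
      · simp [Expr.cost, c]
      · simp [Store.write_apply, Expr.eval, hi.ne, (hi.trans (Nat.lt_succ_self r)).ne,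
          hreg' i (by omega), hreg i hi]
      · simp only [Store.write_apply, Expr.eval]
        simp only [Nat.succ_ne_self, and_false, if_false, and_self, if_true]
        rw [hreg' _ (by omega), hctr]
        omega
      · have : N - j' = N - (j' + 1) + 1 := by omega
        simp [Store.write_apply, Expr.eval, hv, hreg' r (by omega), hsum, this,
          Finset.sum_range_succ]
    have hstart : I N ((σ'.write R r 0).write R (r + 1) 0) := by
      refine ⟨le_rfl, (hσ.write_reg _ _).write_reg _ _, fun i hi => ?_, ?_, ?_⟩
      · simp [Store.write_apply, hi.ne, (hi.trans (Nat.lt_succ_self r)).ne]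
      · simp [Store.write_apply]
      · simp [Store.write_apply]
    obtain ⟨t, τ, hr, ht, ⟨j, hj, hj', hA, hreg, hctr, hsum⟩, hb⟩ :=
      Run.loop_of_budget hbody N _ hstart
    have hj0 : N - j = N := by
      simp only [hbd, Expr.eval, Expr.eval_mulSize, hctr, hA 0 (by omega), ← hN] at hb
      omega
    refine ⟨_, τ, .seq (.seq (.store _ _ _ _) (.store _ _ _ _)) hr, ?_, hA, hreg, ?_⟩
    · simpa [Expr.cost] using ht
    · rw [hsum, hj0, eval]

/-! ### Commands with bounded loops and their compilation -/

/-- Programs made of assignments and loops whose length is a fixed multiple of the number in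
cell 0 of array 0. -/
inductive Cmd : Type
  /-- write the value of `e` to the cell of array `a` whose index is the value of `i` -/
  | write (a : ℕ) (i e : Term) : Cmd
  /-- run `p`, then `q` -/
  | seq (p q : Cmd) : Cmd
  /-- run `p` where `x` runs through the numbers below `m * n` -/
  | upto (x m : ℕ) (p : Cmd) : Cmd

/-- Apply `f 0`, …, `f (N - 1)` in turn. -/
def iterUpto (f : ℕ → Store → Store) (σ : Store) : ℕ → Store
  | 0 => σ
  | N + 1 => f N (iterUpto f σ N)

/-- The memory after a program has been run. -/
def Cmd.exec : Cmd → (ℕ → ℕ) → Store → Store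
  | .write a i e, ρ, σ => σ.write a (i.eval σ ρ) (e.eval σ ρ)
  | .seq p q, ρ, σ => q.exec ρ (p.exec ρ σ)
  | .upto x m p, ρ, σ => iterUpto (fun i τ => p.exec (update ρ x i) τ) σ (m * σ 0 0)

/-- A number above all the arrays that a program mentions. -/
def Cmd.arrays : Cmd → ℕ
  | .write a i e => max (a + 1) (max i.arrays e.arrays)
  | .seq p q => max p.arrays q.arrays
  | .upto _ _ p => p.arrays

/-- The program does not change array 0. -/
def Cmd.KeepsSize : Cmd → Prop
  | .write a _ _ => a ≠ 0
  | .seq p q => p.KeepsSize ∧ q.KeepsSize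
  | .upto _ _ p => p.KeepsSize

/-- The compiled program, which uses the registers from `r` on. -/
def Cmd.compile (R : ℕ) : Cmd → (ℕ → ℕ) → ℕ → Prog
  | .write a i e, κ, r => .seq (.seq (i.compile R κ r) (e.compile R κ (r + 1)))
      (.store a (.reg R r) (.reg R (r + 1)))
  | .seq p q, κ, r => .seq (p.compile R κ r) (q.compile R κ r)
  | .upto x m p, κ, r => .seq (.setReg R r (.lit 0))
      (.loop (.minus (.mulSize m) (.reg R r))
        (.seq (p.compile R (update κ x r) (r + 1))
          (.setReg R r (.plus (.reg R r) (.lit 1)))))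

theorem Cmd.iterUpto_size {c : Cmd}
    (hc : ∀ ρ σ, c.exec ρ σ 0 = σ 0) (ρ : ℕ → ℕ) (x : ℕ) (σ : Store) (N : ℕ) :
    iterUpto (fun i τ => c.exec (update ρ x i) τ) σ N 0 = σ 0 := by
  induction N with
  | zero => rfl
  | succ N ih => rw [RAM.iterUpto, hc, ih]

/-- Since n lives in array 0, this makes every loop length and time bound refer to the initial n,
even after other commands have run. -/
theorem Cmd.exec_size {c : Cmd} (hc : c.KeepsSize) (ρ : ℕ → ℕ) (σ : Store) :
    c.exec ρ σ 0 = σ 0 := by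
  induction c generalizing ρ σ with
  | write a i e => exact Store.write_of_ne _ _ _ (Ne.symm hc)
  | seq p q ihp ihq => rw [exec, ihq hc.2, ihp hc.1]
  | upto x m p ih => exact Cmd.iterUpto_size (ih hc) ρ x σ _

/-- A program does what its compiled form does, in polynomial time. -/
theorem Cmd.exists_run_compile (R : ℕ) (c : Cmd) (κ : ℕ → ℕ) (r : ℕ) (h0 : 0 < R)
    (hR : c.arrays ≤ R) (hc : c.KeepsSize) (hκ : ∀ x, κ x < r) :
    ∃ T, PolyBounded T ∧ ∀ (σ σ' : Store) (ρ : ℕ → ℕ), AgreeBelow R σ σ' →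
      (∀ x, σ' R (κ x) = ρ x) → ∃ t τ, Run (c.compile R κ r) σ' t τ ∧ t ≤ T (σ 0 0) ∧
        AgreeBelow R (c.exec ρ σ) τ ∧ ∀ i < r, τ R i = σ' R i := by
  induction c generalizing κ r with
  | write a i e =>
    simp only [arrays, max_le_iff] at hR
    obtain ⟨T₁, hT₁, h₁⟩ := i.exists_compileSpec R κ r hR.2.1 hκ
    obtain ⟨T₂, hT₂, h₂⟩ := e.exists_compileSpec R κ (r + 1) hR.2.2
      (fun x => (hκ x).trans (by omega))
    refine ⟨fun n => T₁ n + T₂ n + ((Expr.reg R r).cost + (Expr.reg R (r + 1)).cost + 1),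
      (hT₁.add hT₂).add (.const _), fun σ σ' ρ hσ hρ => ?_⟩
    obtain ⟨t, τ, hr, ht, hA, hreg, hv, hv'⟩ := Term.compileSpec_binary hκ h₁ h₂ σ σ' ρ hσ hρ
    refine ⟨_, _, .seq hr (.store _ _ _ _), Nat.add_le_add_right ht _, fun b hb => ?_,
      fun j hj => ?_⟩
    · funext j
      simp only [exec, Store.write_apply, Expr.eval, hv, hv', hA b hb]
    · rw [Store.write_of_ne _ _ _ (by omega), hreg j hj]
  | seq p q ihp ihq =>
    simp only [arrays, max_le_iff] at hR
    obtain ⟨T₁, hT₁, h₁⟩ := ihp κ r hR.1 hc.1 hκ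
    obtain ⟨T₂, hT₂, h₂⟩ := ihq κ r hR.2 hc.2 hκ
    refine ⟨fun n => T₁ n + T₂ n, hT₁.add hT₂, fun σ σ' ρ hσ hρ => ?_⟩
    obtain ⟨t, τ, hr, ht, hA, hreg⟩ := h₁ σ σ' ρ hσ hρ
    obtain ⟨t', τ', hr', ht', hA', hreg'⟩ := h₂ _ τ ρ hA (fun x => by rw [hreg _ (hκ x), hρ])
    rw [exec_size hc.1] at ht'
    exact ⟨_, τ', .seq hr hr', by dsimp only; omega, hA', fun i hi => by rw [hreg' i hi, hreg i hi]⟩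
  | upto x m p ih =>
    obtain ⟨T, hT, h⟩ := ih (update κ x r) (r + 1) hR hc (fun y => by
      by_cases hy : y = x
      · simp [hy]
      · simpa [hy] using (hκ y).trans (Nat.lt_succ_self r))
    set bd : Expr := .minus (.mulSize m) (.reg R r) with hbd
    let c : ℕ := 100
    refine ⟨fun n => 3 + (m * n + 1) * (bd.cost + 1 + (T n + c)),
      (PolyBounded.const _).add ((((PolyBounded.const m).mul .id).add (.const _)).mul
        ((PolyBounded.const _).add (hT.add (.const _)))), fun σ σ' ρ hσ hρ => ?_⟩
    set N := m * σ 0 0 with hN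
    let S : ℕ → Store := iterUpto (fun i τ => p.exec (update ρ x i) τ) σ
    have hS : ∀ i, S i 0 = σ 0 := Cmd.iterUpto_size (exec_size (c := p) hc) ρ x σ
    let I : ℕ → Store → Prop := fun j τ => j ≤ N ∧ AgreeBelow R (S (N - j)) τ ∧
      (∀ i < r, τ R i = σ' R i) ∧ τ R r = N - j
    have hbody : ∀ j τ, I j τ → bd.eval τ ≠ 0 → ∃ j', j = j' + 1 ∧ ∃ t τ',
        Run (.seq (p.compile R (update κ x r) (r + 1))
            (.setReg R r (.plus (.reg R r) (.lit 1)))) τ t τ' ∧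
          t ≤ T (σ 0 0) + c ∧ I j' τ' := by
      rintro j τ ⟨hj, hA, hreg, hctr⟩ hb
      have hj0 : j ≠ 0 := by
        rintro rfl
        apply hb
        simp [hbd, Expr.eval, hctr, hN, hA 0 (by omega), hS]
      obtain ⟨j', rfl⟩ := Nat.exists_eq_succ_of_ne_zero hj0
      obtain ⟨t, τ', hr, ht, hA', hreg'⟩ := h _ τ (update ρ x (N - (j' + 1))) hA (fun y => by
        by_cases hy : y = x
        · subst hy
          simp [hctr]
        · simp [hy, hreg _ (hκ y), hρ])
      rw [hS] at ht
      have hj' : N - j' = N - (j' + 1) + 1 := by omega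
      refine ⟨j', rfl, _, _, .seq hr (.store _ _ _ _),
        Nat.add_le_add ht ?_, by omega, ?_, fun i hi => ?_, ?_⟩
      · simp [Expr.cost, c]
      · rw [hj']
        exact hA'.write_reg _ _
      · simp [Store.write_apply, Expr.eval, hi.ne, hreg' i (by omega), hreg i hi]
      · simp only [Store.write_apply, Expr.eval, and_self, if_true]
        rw [hreg' _ (by omega), hctr]
        omega
    have hstart : I N (σ'.write R r 0) := by
      refine ⟨le_rfl, ?_, fun i hi => ?_, ?_⟩
      · rw [Nat.sub_self]
        exact hσ.write_reg _ _
      · simp [Store.write_apply, hi.ne]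
      · simp [Store.write_apply]
    obtain ⟨t, τ, hr, ht, ⟨j, hj, hj', hA, hreg, hctr⟩, hb⟩ :=
      Run.loop_of_budget hbody N _ hstart
    have hj0 : N - j = N := by
      simp only [hbd, Expr.eval, Expr.eval_mulSize, hctr, hA 0 (by omega), hS, ← hN] at hb
      omega
    rw [hj0] at hA
    refine ⟨_, τ, .seq (.store _ _ _ _) hr, ?_, hA, hreg⟩
    simpa [Expr.cost] using ht

end RAM

/-! ### Coloring a graph with one color more, along an elimination order of a forest -/

namespace FeedbackColoring

open Finset
open scoped Classical

/-- A graph with vertices `0, …, n - 1`, a set `S` of vertices, and positions of the vertices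
in an elimination order of the forest that `S` leaves. -/
structure Layout where
  /-- the number of vertices -/
  n : ℕ
  /-- adjacency -/
  A : ℕ → ℕ → Prop
  /-- the feedback vertex set -/
  S : ℕ → Prop
  /-- the positions -/
  pos : ℕ → ℕ

namespace Layout

/-- `w` is a neighbor of `v` in the forest that is eliminated before `v`. -/
def Child (L : Layout) (v w : ℕ) : Prop :=
  w < L.n ∧ ¬ L.S w ∧ L.A v w ∧ L.pos w < L.pos v

/-- `w` is a neighbor of `v` in the forest that is eliminated after `v`. -/
def Parent (L : Layout) (v w : ℕ) : Prop :=
  w < L.n ∧ ¬ L.S w ∧ L.A v w ∧ L.pos v < L.pos w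

/-- The positions come from an elimination order of a forest. -/
structure IsForest (L : Layout) : Prop where
  symm : ∀ {u v}, L.A u v → L.A v u
  pos_of_mem : ∀ {v}, v < L.n → L.S v → L.pos v = 0
  pos_ne : ∀ {u v}, u < L.n → v < L.n → ¬ L.S u → ¬ L.S v → L.A u v → L.pos u ≠ L.pos v
  parent_unique : ∀ {v w w'}, v < L.n → ¬ L.S v → L.Parent v w → L.Parent v w' → w = w'
  pos_le : ∀ {v}, v < L.n → L.pos v ≤ L.n

/-- Every one of the colors below `b` occurs among the neighbors of `v` in `S`. -/
def Full (L : Layout) (b : ℕ) (C : ℕ → ℕ) (v : ℕ) : Prop :=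
  ¬ L.S v ∧ ∀ j < b, ∃ s < L.n, L.S s ∧ L.A v s ∧ C s = j

/-- The status of a vertex of the forest: 2 if its color will be guessed, 1 if it has to get the
extra color, and 0 otherwise. -/
noncomputable def status (L : Layout) (full : ℕ → Prop) (Δ : ℕ) (v : ℕ) : ℕ :=
  let X := if full v ∨ ∃ w, ∃ _ : L.Child v w, status L full Δ w = 2 then 1 else 0
  if Δ < (∑ w ∈ range L.n,
    if _ : L.Child v w then (if status L full Δ w = 1 then 1 else 0) else 0) + X then 2 else X
termination_by L.pos v
decreasing_by all_goals exact (by assumption : L.Child v _).2.2.2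

/-- The vertex `v` is full or has a child whose color is guessed. -/
def Forced (L : Layout) (full : ℕ → Prop) (Δ : ℕ) (v : ℕ) : Prop :=
  full v ∨ ∃ w, L.Child v w ∧ L.status full Δ w = 2

/-- The definition carries proofs of the child relation for the sake of termination; they disappear
here. -/
theorem status_eq (L : Layout) (full : ℕ → Prop) (Δ : ℕ) (v : ℕ) :
    L.status full Δ v =
      if Δ < #{w ∈ range L.n | L.Child v w ∧ L.status full Δ w = 1} +
          (if L.Forced full Δ v then 1 else 0) then 2
      else if L.Forced full Δ v then 1 else 0 := by
  rw [status]
  simp only [exists_prop, Forced, card_filter, dite_eq_ite, ite_and]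
  congr

/-- The vertices that get the extra color. -/
def Extra (L : Layout) (st : ℕ → ℕ) (v : ℕ) : Prop :=
  ¬ L.S v ∧ st v ≠ 2 ∧
    (st v = 1 ∨ ¬ ∃ w, ∃ _ : L.Parent v w ∧ L.pos w ≤ L.n, Extra L st w)
termination_by L.n - L.pos v
decreasing_by
  have h : L.Parent v w ∧ L.pos w ≤ L.n := by assumption
  have := h.1.2.2.2
  omega

/-- The clause `L.pos w ≤ L.n` in the definition serves termination only; it is automatic for the
positions of a forest. -/
theorem IsForest.extra_iff {L : Layout} (hL : L.IsForest) (st : ℕ → ℕ) (v : ℕ) :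
    L.Extra st v ↔ ¬ L.S v ∧ st v ≠ 2 ∧ (st v = 1 ∨ ¬ ∃ w, L.Parent v w ∧ L.Extra st w) := by
  rw [Extra]
  have : ∀ w, (∃ _ : L.Parent v w ∧ L.pos w ≤ L.n, L.Extra st w) ↔
      (L.Parent v w ∧ L.Extra st w) := fun w =>
    ⟨fun ⟨h, h'⟩ => ⟨h.1, h'⟩, fun ⟨h, h'⟩ => ⟨⟨h, hL.pos_le h.1⟩, h'⟩⟩
  simp only [this]

/-- The color of a vertex: guessed, extra, or unused among the neighbors in `S`. -/
noncomputable def color (L : Layout) (b : ℕ) (st g c : ℕ → ℕ) (v : ℕ) : ℕ :=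
  if L.S v ∨ st v = 2 then g v else if L.Extra st v then b else c v

variable {L : Layout} {full : ℕ → Prop} {Δ : ℕ}

theorem status_cases (L : Layout) (full : ℕ → Prop) (Δ : ℕ) (v : ℕ) :
    L.status full Δ v = 0 ∨ L.status full Δ v = 1 ∨ L.status full Δ v = 2 := by
  rw [status_eq]
  split_ifs <;> simp

theorem forced_iff_of_status_ne {v : ℕ} (h : L.status full Δ v ≠ 2) :
    L.Forced full Δ v ↔ L.status full Δ v = 1 := by
  rw [status_eq] at h ⊢
  split_ifs at h ⊢ with h₁ h₂ <;> simp_all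

theorem status_eq_two_iff {v : ℕ} :
    L.status full Δ v = 2 ↔ Δ < #{w ∈ range L.n | L.Child v w ∧ L.status full Δ w = 1} +
      (if L.Forced full Δ v then 1 else 0) := by
  rw [status_eq]
  split_ifs <;> simp_all

theorem IsForest.parent_of_child (hL : L.IsForest) {v w : ℕ} (hv : v < L.n) (hS : ¬ L.S v)
    (h : L.Child v w) : L.Parent w v :=
  ⟨hv, hS, hL.symm h.2.2.1, h.2.2.2⟩

/-- A vertex is a child of at most one vertex. -/
theorem IsForest.child_unique (hL : L.IsForest) {v v' w : ℕ} (hv : v < L.n) (hv' : v' < L.n)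
    (h : L.Child v w) (h' : L.Child v' w) : v = v' := by
  -- A vertex with a child has positive position, whereas the vertices of `S` have position 0.
  have key : ∀ {v}, v < L.n → L.Child v w → ¬ L.S v := fun hv h hS => by
    have := h.2.2.2
    rw [hL.pos_of_mem hv hS] at this
    omega
  exact hL.parent_unique h.1 h.2.1 (hL.parent_of_child hv (key hv h) h)
    (hL.parent_of_child hv' (key hv' h') h')

/-! ### Bounding the number of guessed vertices -/

/-- The number of vertices whose color is guessed, in terms of the number of full vertices. -/
theorem IsForest.card_status_two (hL : L.IsForest) :
    Δ * #{v ∈ range L.n | L.status full Δ v = 2} ≤ #{v ∈ range L.n | full v} := by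
  set H := {v ∈ range L.n | L.status full Δ v = 2} with hH
  set Q := {v ∈ range L.n | L.status full Δ v = 1} with hQ
  set X := {v ∈ range L.n | L.Forced full Δ v} with hX
  set P := {v ∈ range L.n | ∃ w, L.Child v w ∧ L.status full Δ w = 2} with hP
  -- The chain is (Δ + 1)·#H ≤ #Q + #(H ∩ X) ≤ #X ≤ #full + #P ≤ #full + #H. Uniqueness of parents
  -- is used twice: for #P ≤ #H, and for the disjointness of the sets of children.
  have h₁ : #X ≤ #{v ∈ range L.n | full v} + #P := by
    rw [hX, hP]
    refine le_trans (card_le_card fun v hv => ?_) (card_union_le _ _)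
    simp only [mem_filter, mem_union] at hv ⊢
    rcases hv.2 with h | h
    exacts [.inl ⟨hv.1, h⟩, .inr ⟨hv.1, h⟩]
  have h₂ : #P ≤ #H := by
    have hex : ∀ v ∈ P, ∃ w, L.Child v w ∧ L.status full Δ w = 2 := fun v hv =>
      (mem_filter.1 hv).2
    choose! f hf using hex
    refine card_le_card_of_injOn f (fun v hv => ?_) fun v hv v' hv' h => ?_
    · have := hf v hv
      exact mem_coe.2 (mem_filter.2 ⟨mem_range.2 this.1.1, this.2⟩)
    · have h' := (hf v' hv').1
      rw [← h] at h'
      exact hL.child_unique (mem_range.1 (mem_filter.1 hv).1) (mem_range.1 (mem_filter.1 hv').1)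
        (hf v hv).1 h'
  have h₃ : ∑ v ∈ H, #{w ∈ range L.n | L.Child v w ∧ L.status full Δ w = 1} ≤ #Q := by
    rw [← card_biUnion]
    · refine card_le_card fun w hw => ?_
      simp only [mem_biUnion, mem_filter] at hw
      obtain ⟨v, -, hw, -, h⟩ := hw
      exact mem_filter.2 ⟨hw, h⟩
    · intro v hv v' hv' hne
      refine disjoint_left.2 fun w hw hw' => hne ?_
      simp only [mem_filter] at hw hw'
      exact hL.child_unique (mem_range.1 (mem_filter.1 hv).1) (mem_range.1 (mem_filter.1 hv').1)
        hw.2.1 hw'.2.1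
  have h₄ : #{v ∈ H | L.Forced full Δ v} + #Q ≤ #X := by
    rw [← card_union_of_disjoint]
    · refine card_le_card fun v hv => ?_
      simp only [mem_union, mem_filter, H, Q, X] at hv ⊢
      rcases hv with h | h
      · exact ⟨h.1.1, h.2⟩
      · exact ⟨h.1, (forced_iff_of_status_ne (by rw [h.2]; decide)).2 h.2⟩
    · refine disjoint_left.2 fun v hv hv' => ?_
      simp only [mem_filter, H, Q] at hv hv'
      omega
  have h₅ : (Δ + 1) * #H ≤
      ∑ v ∈ H, #{w ∈ range L.n | L.Child v w ∧ L.status full Δ w = 1} +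
        #{v ∈ H | L.Forced full Δ v} := by
    rw [card_filter (fun v => L.Forced full Δ v), ← sum_add_distrib, mul_comm, ← smul_eq_mul]
    exact card_nsmul_le_sum _ _ _ fun v hv => status_eq_two_iff.1 (mem_filter.1 hv).2
  rw [add_mul] at h₅
  omega

/-- Full vertices are the only source of nonzero statuses: going up the forest, nothing is ever
forced. This serves the case Δ = 0, where the counting inequality says nothing. -/
theorem status_eq_zero_of_no_full (h : ∀ v < L.n, ¬ full v) (v : ℕ) (hv : v < L.n) :
    L.status full Δ v = 0 := by
  induction hk : L.pos v using Nat.strong_induction_on generalizing v with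
  | _ k ih =>
    have h₁ : ∀ w, L.Child v w → L.status full Δ w = 0 := fun w hw =>
      ih _ (by rw [← hk]; exact hw.2.2.2) w hw.1 rfl
    have h₂ : ¬ L.Forced full Δ v := by
      rintro (h' | ⟨w, hw, h'⟩)
      · exact h v hv h'
      · rw [h₁ w hw] at h'
        omega
    have h₃ : {w ∈ range L.n | L.Child v w ∧ L.status full Δ w = 1} = ∅ := by
      refine filter_eq_empty_iff.2 fun w _ hw => ?_
      rw [h₁ w hw.1] at hw
      omega
    rw [status_eq, h₃]
    simp [h₂]

/-- In a coloring of defect at most `Δ`, every vertex of `S` is in conflict with at most `Δ` full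
vertices. -/
theorem IsForest.card_full (hL : L.IsForest) {b : ℕ} {g : ℕ → ℕ} (hg : ∀ v < L.n, g v < b)
    (hd : ∀ v < L.n, #{w ∈ range L.n | L.A v w ∧ g w = g v} ≤ Δ) :
    #{v ∈ range L.n | L.Full b g v} ≤ #{v ∈ range L.n | L.S v} * Δ := by
  refine le_trans (card_le_card (t := ({v ∈ range L.n | L.S v}).biUnion
    fun s => {w ∈ range L.n | L.A s w ∧ g w = g s}) fun v hv => ?_)
    (card_biUnion_le_card_mul _ _ _ fun s hs => hd s (mem_range.1 (mem_filter.1 hs).1))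
  obtain ⟨hv, -, hfull⟩ := mem_filter.1 hv
  -- The color to look for is that of `v` itself: it occurs at a neighbor `s` in `S`, so `v` is one
  -- of the at most Δ conflicts of `s`.
  obtain ⟨s, hs, hS, hA, h⟩ := hfull _ (hg v (mem_range.1 hv))
  exact mem_biUnion.2 ⟨s, mem_filter.2 ⟨mem_range.2 hs, hS⟩,
    mem_filter.2 ⟨hv, hL.symm hA, h.symm⟩⟩

/-- Cancel Δ in Δ·#guessed ≤ #full ≤ #S·Δ. If Δ = 0, there are no full vertices and hence no guessed
ones. -/
theorem IsForest.card_guessed_le (hL : L.IsForest) {b : ℕ} {g : ℕ → ℕ}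
    (hg : ∀ v < L.n, g v < b)
    (hd : ∀ v < L.n, #{w ∈ range L.n | L.A v w ∧ g w = g v} ≤ Δ) :
    #{v ∈ range L.n | L.status (L.Full b g) Δ v = 2} ≤ #{v ∈ range L.n | L.S v} := by
  have h₁ := hL.card_full hg hd
  have h₂ := hL.card_status_two (full := L.Full b g) (Δ := Δ)
  rcases Nat.eq_zero_or_pos Δ with rfl | hΔ
  · have h₃ : ∀ v < L.n, ¬ L.Full b g v := fun v hv hf => by
      rw [mul_zero, Nat.le_zero, card_eq_zero, filter_eq_empty_iff] at h₁
      exact h₁ (mem_range.2 hv) hf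
    rw [filter_eq_empty_iff.2 fun v hv => ?_]
    · simp
    · rw [status_eq_zero_of_no_full h₃ v (mem_range.1 hv)]
      decide
  · rw [mul_comm] at h₁
    exact Nat.le_of_mul_le_mul_left (h₂.trans h₁) hΔ

/-! ### Defect of the resulting coloring -/

/-- The coloring has defect at most `Δ` if the guessed colors come from a coloring with defect
at most `Δ`. -/
theorem IsForest.card_color_le (hL : L.IsForest) {b : ℕ} {g c : ℕ → ℕ}
    (hg : ∀ v < L.n, g v < b)
    (hd : ∀ v < L.n, #{w ∈ range L.n | L.A v w ∧ g w = g v} ≤ Δ)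
    (hc : ∀ v < L.n, ¬ L.S v → ¬ L.Full b g v →
      c v < b ∧ ∀ s < L.n, L.S s → L.A v s → g s ≠ c v)
    (v : ℕ) (hv : v < L.n) :
    #{w ∈ range L.n | L.A v w ∧ L.color b (L.status (L.Full b g) Δ) g c w =
      L.color b (L.status (L.Full b g) Δ) g c v} ≤ Δ := by
  set st := L.status (L.Full b g) Δ with hst
  set col := L.color b st g c with hcol
  have hfull : ∀ v, L.Full b g v → ¬ L.S v := fun v h => h.1
  -- the four kinds of vertices
  have colG : ∀ {w}, L.S w ∨ st w = 2 → col w = g w := fun h => by rw [hcol, color, if_pos h]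
  have colE : ∀ {w}, L.Extra st w → col w = b := fun {w} h => by
    have h' := (hL.extra_iff st w).1 h
    rw [hcol, color, if_neg (by tauto), if_pos h]
  have colF : ∀ {w}, ¬ (L.S w ∨ st w = 2) → ¬ L.Extra st w → col w = c w := fun h h' => by
    rw [hcol, color, if_neg h, if_neg h']
  have free : ∀ {w}, w < L.n → ¬ (L.S w ∨ st w = 2) → ¬ L.Extra st w →
      st w = 0 ∧ ¬ L.Forced (L.Full b g) Δ w ∧ c w < b ∧
        ∀ s < L.n, L.S s → L.A w s → g s ≠ c w := fun {w} hw h h' => by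
    push Not at h
    have h0 : st w ≠ 1 := fun h1 => h' ((hL.extra_iff st w).2 ⟨h.1, h.2, .inl h1⟩)
    have hF : ¬ L.Forced (L.Full b g) Δ w := fun hF => h0 ((forced_iff_of_status_ne h.2).1 hF)
    refine ⟨?_, hF, hc w hw h.1 fun hf => hF (.inl hf)⟩
    rcases status_cases L (L.Full b g) Δ w with h'' | h'' | h''
    exacts [h'', absurd h'' h0, absurd h'' h.2]
  -- Without status 1, the extra color is taken only when the parent does not have it.
  have one : ∀ {w}, L.Extra st w → st w ≠ 1 → ∀ u, L.Parent w u → ¬ L.Extra st u :=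
    fun {w} h h1 u hu hE => by
      have h' := (hL.extra_iff st w).1 h
      rcases h'.2.2 with h2 | h2
      · exact h1 h2
      · exact h2 ⟨u, hu, hE⟩
  -- The only reason to be refused the extra color is a parent that has it.
  have zero : ∀ {w}, ¬ (L.S w ∨ st w = 2) → ¬ L.Extra st w → ∃ u, L.Parent w u ∧ L.Extra st u :=
    fun {w} h h' => by
      rw [hL.extra_iff] at h'
      push Not at h h'
      exact (h' h.1 h.2).2
  have forestPos : ∀ {w}, w < L.n → ¬ L.S v → ¬ L.S w → L.A v w → L.Child v w ∨ L.Parent v w :=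
    fun {w} hw hvS hwS hA => by
      rcases Nat.lt_or_gt_of_ne (hL.pos_ne hv hw hvS hwS hA) with h | h
      exacts [.inr ⟨hw, hwS, hA, h⟩, .inl ⟨hw, hwS, hA, h⟩]
  by_cases hvG : L.S v ∨ st v = 2
  · -- guessed: all conflicts are conflicts of `g`
    refine le_trans (card_le_card fun w hw => ?_) (hd v hv)
    simp only [mem_filter, mem_range] at hw ⊢
    obtain ⟨hw, hA, h⟩ := hw
    refine ⟨hw, hA, ?_⟩
    rw [colG hvG] at h
    by_cases hwG : L.S w ∨ st w = 2
    · rw [← colG hwG, h]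
    exfalso
    by_cases hwE : L.Extra st w
    · rw [colE hwE] at h
      have := hg v hv
      omega
    · obtain ⟨-, hF, hcb, hcf⟩ := free hw hwG hwE
      rw [colF hwG hwE] at h
      by_cases hvS : L.S v
      · exact hcf v hv hvS (hL.symm hA) h.symm
      · have hv2 : st v = 2 := hvG.resolve_left hvS
        push Not at hwG
        rcases forestPos hw hvS hwG.1 hA with hch | hpa
        · obtain ⟨u, hu, huE⟩ := zero (by tauto) hwE
          obtain rfl := hL.parent_unique hw hwG.1 hu (hL.parent_of_child hv hvS hch)
          exact ((hL.extra_iff st u).1 huE).2.1 hv2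
        -- The parent of a guessed vertex is forced, hence never takes an unused color.
        · exact hF (.inr ⟨v, ⟨hv, hvS, hL.symm hA, hpa.2.2.2⟩, hv2⟩)
  · have hvS : ¬ L.S v := fun h => hvG (.inl h)
    by_cases hvE : L.Extra st v
    · -- the extra color: only forced children and, for a forced vertex, the parent
      have hsub : ∀ w ∈ {w ∈ range L.n | L.A v w ∧ col w = col v},
          L.Extra st w ∧ ((L.Child v w ∧ st w = 1) ∨ L.Parent v w) := fun w hw => by
        simp only [mem_filter, mem_range] at hw
        obtain ⟨hw, hA, h⟩ := hw
        rw [colE hvE] at h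
        have hwG : ¬ (L.S w ∨ st w = 2) := fun hwG => by
          rw [colG hwG] at h
          have := hg w hw
          omega
        have hwE : L.Extra st w := by
          by_contra hwE
          rw [colF hwG hwE] at h
          have := (free hw hwG hwE).2.2.1
          omega
        refine ⟨hwE, ?_⟩
        have hwS : ¬ L.S w := fun h => hwG (.inl h)
        rcases forestPos hw hvS hwS hA with hch | hpa
        · refine .inl ⟨hch, ?_⟩
          by_contra h1
          exact one hwE h1 v (hL.parent_of_child hv hvS hch) hvE
        · exact .inr hpa
      have hv2 : st v ≠ 2 := fun h => hvG (.inr h)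
      have hle := mt status_eq_two_iff.2 hv2
      rw [not_lt] at hle
      by_cases h1 : st v = 1
      · rw [if_pos ((forced_iff_of_status_ne hv2).2 h1)] at hle
        refine le_trans ?_ hle
        by_cases hpar : ∃ u, L.Parent v u
        · obtain ⟨u, hu⟩ := hpar
          refine le_trans (card_le_card fun w hw => ?_) (card_insert_le u _)
          rcases (hsub w hw).2 with h | h
          · exact mem_insert_of_mem (mem_filter.2 ⟨(mem_filter.1 hw).1, h⟩)
          · rw [hL.parent_unique hv hvS h hu]
            exact mem_insert_self _ _
        · refine le_trans (card_le_card fun w hw => ?_) (Nat.le_succ _)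
          rcases (hsub w hw).2 with h | h
          · exact mem_filter.2 ⟨(mem_filter.1 hw).1, h⟩
          · exact absurd ⟨w, h⟩ hpar
      · refine le_trans (card_le_card fun w hw => ?_) ((Nat.le_add_right _ _).trans hle)
        obtain ⟨hwE, h | h⟩ := hsub w hw
        · exact mem_filter.2 ⟨(mem_filter.1 hw).1, h⟩
        · exact absurd hwE (one hvE h1 w h)
    · -- an unused color: no conflicts
      obtain ⟨-, hF, hcb, hcf⟩ := free hv hvG hvE
      rw [card_eq_zero.2 (filter_eq_empty_iff.2 fun w hw => ?_)]
      · exact Nat.zero_le _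
      rintro ⟨hA, h⟩
      have hw := mem_range.1 hw
      rw [colF hvG hvE] at h
      by_cases hwS : L.S w
      · rw [colG (.inl hwS)] at h
        exact hcf w hw hwS hA h
      by_cases hwE : L.Extra st w
      · rw [colE hwE] at h
        omega
      rcases forestPos hw hvS hwS hA with hch | hpa
      · by_cases hw2 : st w = 2
        · exact hF (.inr ⟨w, hch, hw2⟩)
        · obtain ⟨u, hu, huE⟩ := zero (by tauto) hwE
          obtain rfl := hL.parent_unique hw hwS hu (hL.parent_of_child hv hvS hch)
          exact hvE huE
      · obtain ⟨u, hu, huE⟩ := zero hvG hvE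
        obtain rfl := hL.parent_unique hv hvS hu hpa
        exact hwE huE

end Layout

end FeedbackColoring

/-! ### Logical operations, counting and minimization as terms; filling arrays -/

namespace RAM

open Function Finset
open scoped Classical

/-- The value of the term is nonzero. -/
def Term.Holds (σ : Store) (e : Term) (ρ : ℕ → ℕ) : Prop := e.eval σ ρ ≠ 0

namespace Term

/-- negation -/
def not (e : Term) : Term := .minus (.lit 1) e
/-- conjunction -/
def and (e₁ e₂ : Term) : Term := .ite e₁ e₂ (.lit 0)
/-- disjunction -/
def or (e₁ e₂ : Term) : Term := .ite e₁ (.lit 1) e₂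
/-- comparison -/
def lt (e₁ e₂ : Term) : Term := .minus e₂ e₁
/-- equality -/
def eq (e₁ e₂ : Term) : Term := .not (.plus (.minus e₁ e₂) (.minus e₂ e₁))
/-- the number of `x` below `m * n` such that `e` holds -/
def count (x m : ℕ) (e : Term) : Term := .sum x m (.ite e (.lit 1) (.lit 0))
/-- there is an `x` below `m * n` such that `e` holds -/
def ex (x m : ℕ) (e : Term) : Term := .sum x m e
/-- `e` holds for all `x` below `m * n` -/
def all (x m : ℕ) (e : Term) : Term := .not (.ex x m (.not e))
/-- the least `y` below `m * n` such that `e` holds, or `m * n` if there is none;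
`x` is an auxiliary variable -/
def least (x y m : ℕ) (e : Term) : Term :=
  .count x m (.all y m (.not (.and (.lt (.var y) (.plus (.var x) (.lit 1))) e)))

variable (σ : Store) (ρ : ℕ → ℕ) (e e₁ e₂ : Term) (x y m : ℕ)

@[simp] theorem eval_lit (k : ℕ) : (lit k).eval σ ρ = k := rfl
@[simp] theorem eval_var : (var x).eval σ ρ = ρ x := rfl
@[simp] theorem eval_cell (a : ℕ) : (cell a e).eval σ ρ = σ a (e.eval σ ρ) := rfl
@[simp] theorem eval_plus : (plus e₁ e₂).eval σ ρ = e₁.eval σ ρ + e₂.eval σ ρ := rfl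
@[simp] theorem eval_minus : (minus e₁ e₂).eval σ ρ = e₁.eval σ ρ - e₂.eval σ ρ := rfl
@[simp] theorem eval_sum : (sum x m e).eval σ ρ =
    ∑ i ∈ range (m * σ 0 0), e.eval σ (update ρ x i) := rfl
@[simp] theorem eval_ite : (ite e e₁ e₂).eval σ ρ =
    if e.Holds σ ρ then e₁.eval σ ρ else e₂.eval σ ρ := by
  unfold Holds
  rw [eval]
  congr

@[simp] theorem holds_cell (a : ℕ) : (cell a e).Holds σ ρ ↔ σ a (e.eval σ ρ) ≠ 0 := Iff.rfl

@[simp] theorem holds_not : e.not.Holds σ ρ ↔ ¬ e.Holds σ ρ := by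
  simp only [Holds, not, eval_minus, eval_lit]
  omega

@[simp] theorem holds_and : (e₁.and e₂).Holds σ ρ ↔ e₁.Holds σ ρ ∧ e₂.Holds σ ρ := by
  rw [Holds, and, eval_ite]
  split_ifs with h
  · exact (and_iff_right h).symm
  · simp [h]

@[simp] theorem holds_or : (e₁.or e₂).Holds σ ρ ↔ e₁.Holds σ ρ ∨ e₂.Holds σ ρ := by
  rw [Holds, or, eval_ite]
  split_ifs with h
  · simp [h]
  · exact (or_iff_right h).symm

@[simp] theorem holds_lt : (e₁.lt e₂).Holds σ ρ ↔ e₁.eval σ ρ < e₂.eval σ ρ := by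
  simp only [Holds, lt, eval_minus]
  omega

@[simp] theorem holds_eq : (e₁.eq e₂).Holds σ ρ ↔ e₁.eval σ ρ = e₂.eval σ ρ := by
  rw [eq, holds_not, Holds, eval_plus, eval_minus, eval_minus]
  omega

@[simp] theorem holds_ex : (ex x m e).Holds σ ρ ↔
    ∃ i < m * σ 0 0, e.Holds σ (update ρ x i) := by
  simp [Holds, ex, Finset.sum_eq_zero_iff]

@[simp] theorem holds_all : (all x m e).Holds σ ρ ↔
    ∀ i < m * σ 0 0, e.Holds σ (update ρ x i) := by
  simp [all]

@[simp] theorem eval_count : (count x m e).eval σ ρ =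
    #{i ∈ range (m * σ 0 0) | e.Holds σ (update ρ x i)} := by
  simp only [count, eval_sum, eval_ite, eval_lit, card_filter]

/-- The verdict is an `all` term written directly to the output cell, so its value, not just its
truth, must be 0 or 1. -/
theorem eval_all : (all x m e).eval σ ρ = if (all x m e).Holds σ ρ then 1 else 0 := by
  split_ifs with h
  · simp only [Holds, all, not, eval_minus, eval_lit] at h ⊢
    omega
  · simpa [Holds] using h

end Term

/-- The least number below `N` with the property `p`, or `N` if there is none. -/
noncomputable def leastBelow (N : ℕ) (p : ℕ → Prop) : ℕ :=
  #{x ∈ range N | ∀ y < N, ¬ (y < x + 1 ∧ p y)}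

/-- The numbers counted are those up to which no solution has occurred; they form the initial
segment below the first solution. -/
theorem leastBelow_eq {N : ℕ} {p : ℕ → Prop} {x : ℕ} (hx : x < N) (hp : p x)
    (h : ∀ y < x, ¬ p y) : leastBelow N p = x := by
  rw [leastBelow, ← card_range x]
  congr 1
  ext y
  simp only [mem_filter, mem_range]
  constructor
  · rintro ⟨-, h'⟩
    by_contra hy
    exact h' x hx ⟨by omega, hp⟩
  · exact fun hy => ⟨by omega, fun z _ hz => h z (by omega) hz.2⟩

theorem leastBelow_spec {N : ℕ} {p : ℕ → Prop} (h : ∃ x < N, p x) :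
    leastBelow N p < N ∧ p (leastBelow N p) ∧ ∀ y < leastBelow N p, ¬ p y := by
  have h' : ∃ x, p x ∧ x < N := h.imp fun x hx => ⟨hx.2, hx.1⟩
  have h₁ := Nat.find_spec h'
  have h₂ : ∀ y < Nat.find h', ¬ p y := fun y hy hp =>
    Nat.find_min h' hy ⟨hp, hy.trans h₁.2⟩
  rw [leastBelow_eq h₁.2 h₁.1 h₂]
  exact ⟨h₁.2, h₁.1, h₂⟩

theorem leastBelow_of_not_exists {N : ℕ} {p : ℕ → Prop} (h : ¬ ∃ x < N, p x) :
    leastBelow N p = N := by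
  rw [leastBelow, filter_true_of_mem, card_range]
  exact fun x _ y hy hp => h ⟨y, hy, hp.2⟩

theorem leastBelow_congr {N : ℕ} {p q : ℕ → Prop} (h : ∀ x < N, p x ↔ q x) :
    leastBelow N p = leastBelow N q := by
  unfold leastBelow
  congr 1
  refine filter_congr fun x _ => forall₂_congr fun y hy => ?_
  rw [h y hy]

theorem Term.eval_least {σ : Store} {ρ : ℕ → ℕ} {e : Term} {x y m : ℕ} (hxy : x ≠ y)
    {p : ℕ → Prop}
    (h : ∀ i j, j < m * σ 0 0 → (e.Holds σ (update (update ρ x i) y j) ↔ p j)) :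
    (least x y m e).eval σ ρ = leastBelow (m * σ 0 0) p := by
  rw [least, eval_count, leastBelow]
  congr 1
  refine filter_congr fun i _ => ?_
  rw [holds_all]
  refine forall₂_congr fun j hj => ?_
  rw [holds_not, holds_and, holds_lt, h i j hj]
  simp [hxy]

/-! ### Loop invariants and filling arrays -/

/-- An invariant of a loop. -/
theorem Cmd.exec_upto_induction {x m : ℕ} {p : Cmd} {ρ : ℕ → ℕ} {σ : Store}
    (I : ℕ → Store → Prop) (h0 : I 0 σ)
    (h : ∀ i τ, i < m * σ 0 0 → I i τ → I (i + 1) (p.exec (update ρ x i) τ)) :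
    I (m * σ 0 0) ((Cmd.upto x m p).exec ρ σ) := by
  have key : ∀ N ≤ m * σ 0 0, I N (iterUpto (fun i τ => p.exec (update ρ x i) τ) σ N) := by
    intro N hN
    induction N with
    | zero => exact h0
    | succ N ih => exact h N _ hN (ih (by omega))
  exact key _ le_rfl

/-- The memories differ in array `a` only. -/
def SameBut (a : ℕ) (σ τ : Store) : Prop := ∀ c ≠ a, τ c = σ c

/-- Assign to `a[x]` the value of `e`, for all `x` below `m * n`. -/
def Cmd.fill (a x m : ℕ) (e : Term) : Cmd := .upto x m (.write a (.var x) e)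

/-- The array `a` holds the numbers `g 0`, …, `g (N - 1)`, and is otherwise as in `σ`. -/
def Store.setArray (σ : Store) (a N : ℕ) (g : ℕ → ℕ) : Store :=
  update σ a fun v => if v < N then g v else σ a v

theorem Store.setArray_of_ne (σ : Store) {a c : ℕ} (N : ℕ) (g : ℕ → ℕ) (h : c ≠ a) :
    σ.setArray a N g c = σ c := by
  rw [setArray, update_of_ne h]

theorem Store.setArray_of_lt (σ : Store) {a N v : ℕ} (g : ℕ → ℕ) (h : v < N) :
    σ.setArray a N g a v = g v := by
  rw [setArray, update_self, if_pos h]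

theorem Store.eq_setArray {σ τ : Store} {a N : ℕ} {g : ℕ → ℕ} (h : SameBut a σ τ)
    (h₁ : ∀ v, N ≤ v → τ a v = σ a v) (h₂ : ∀ v < N, τ a v = g v) : τ = σ.setArray a N g := by
  funext c v
  by_cases hc : c = a
  · subst hc
    by_cases hv : v < N
    · rw [setArray_of_lt _ _ hv, h₂ v hv]
    · rw [h₁ v (by omega), setArray, update_self, if_neg hv]
  · rw [setArray_of_ne _ _ _ hc, h c hc]

theorem SameBut.write {a : ℕ} {σ τ : Store} (h : SameBut a σ τ) (i v : ℕ) :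
    SameBut a σ (τ.write a i v) := fun c hc => by
  rw [Store.write_of_ne _ _ _ hc, h c hc]

/-- The hypothesis ranges over all stores that differ in array `a` only, so the values must not
depend on what has already been filled in. -/
theorem Cmd.exec_fill {a x m : ℕ} {e : Term} {ρ : ℕ → ℕ} {σ : Store} (g : ℕ → ℕ)
    (h : ∀ τ, SameBut a σ τ → ∀ v < m * σ 0 0, e.eval τ (update ρ x v) = g v) :
    (fill a x m e).exec ρ σ = σ.setArray a (m * σ 0 0) g := by
  obtain ⟨h₁, h₂, h₃⟩ := Cmd.exec_upto_induction (x := x) (m := m) (p := .write a (.var x) e)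
    (ρ := ρ) (σ := σ) (fun i τ => SameBut a σ τ ∧ (∀ v, i ≤ v → τ a v = σ a v) ∧
      ∀ v < i, τ a v = g v)
    ⟨fun _ _ => rfl, fun _ _ => rfl, fun v hv => absurd hv (Nat.not_lt_zero v)⟩
    (by
      rintro i τ hi ⟨h₁, h₂, h₃⟩
      refine ⟨h₁.write _ _, fun v hv => ?_, fun v hv => ?_⟩
      · have : v ≠ i := by omega
        simp [Cmd.exec, Store.write_apply, this, h₂ v (by omega)]
      · by_cases hvi : v = i
        · simp [Cmd.exec, Store.write_apply, hvi, h τ h₁ i hi]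
        · simp [Cmd.exec, Store.write_apply, hvi, h₃ v (by omega)])
  exact Store.eq_setArray h₁ h₂ h₃

/-- Repeated assignments compute a function whose value at `v` depends only on values at
arguments of smaller rank. -/
theorem Cmd.exec_upto_fill {a x y m m' : ℕ} {e : Term} {ρ : ℕ → ℕ} {σ : Store}
    (ha : a ≠ 0) (g rk : ℕ → ℕ)
    (h : ∀ τ, SameBut a σ τ → ∀ t, ∀ v < m * σ 0 0,
      (∀ w < m * σ 0 0, rk w < rk v → τ a w = g w) →
        e.eval τ (update (update ρ y t) x v) = g v)
    (hrk : ∀ v < m * σ 0 0, rk v < m' * σ 0 0) :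
    (Cmd.upto y m' (fill a x m e)).exec ρ σ = σ.setArray a (m * σ 0 0) g := by
  obtain ⟨h₁, h₂, h₃⟩ := Cmd.exec_upto_induction (x := y) (m := m') (p := fill a x m e)
    (ρ := ρ) (σ := σ) (fun t τ => SameBut a σ τ ∧ (∀ v, m * σ 0 0 ≤ v → τ a v = σ a v) ∧
      ∀ v < m * σ 0 0, rk v < t → τ a v = g v)
    ⟨fun _ _ => rfl, fun _ _ => rfl, fun v _ hv => absurd hv (Nat.not_lt_zero _)⟩
    (by
      rintro t τ - ⟨h₁, h₂, h₃⟩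
      have hsize : τ 0 0 = σ 0 0 := by rw [h₁ 0 ha.symm]
      have := Cmd.exec_upto_induction (x := x) (m := m) (p := .write a (.var x) e)
        (ρ := update ρ y t) (σ := τ) (fun i τ' => SameBut a σ τ' ∧
          (∀ v, m * σ 0 0 ≤ v → τ' a v = σ a v) ∧
          (∀ v < m * σ 0 0, rk v < t → τ' a v = g v) ∧
          ∀ v < i, rk v < t + 1 → τ' a v = g v)
        ⟨h₁, h₂, h₃, fun v hv => absurd hv (Nat.not_lt_zero v)⟩
        (by
          rw [hsize]
          rintro i τ' hi ⟨h₁, h₂, h₃, h₄⟩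
          -- In sweep `t`, an entry of rank at most `t` is computed from correct entries. So
          -- rewriting an entry of smaller rank leaves it correct, and entries of rank `t` become
          -- correct.
          have hval : ∀ rk', rk i < rk' → rk' ≤ t + 1 →
              e.eval τ' (update (update ρ y t) x i) = g i := fun rk' hr hr' =>
            h τ' h₁ t i hi fun w hw hwi => h₃ w hw (by omega)
          refine ⟨h₁.write _ _, fun v hv => ?_, fun v hv hr => ?_, fun v hv hr => ?_⟩
          · have : v ≠ i := by omega
            simp [Cmd.exec, Store.write_apply, this, h₂ v hv]
          · by_cases hvi : v = i
            · subst hvi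
              simp [Cmd.exec, Store.write_apply, hval t hr (by omega)]
            · simp [Cmd.exec, Store.write_apply, hvi, h₃ v hv hr]
          · by_cases hvi : v = i
            · subst hvi
              simp [Cmd.exec, Store.write_apply, hval (t + 1) hr le_rfl]
            · simp [Cmd.exec, Store.write_apply, hvi, h₄ v (by omega) hr])
      rw [hsize] at this
      exact ⟨this.1, this.2.1, this.2.2.2⟩)
  exact Store.eq_setArray h₁ h₂ fun v hv => h₃ v hv (hrk v hv)

end RAM

/-! ### The coloring program -/

namespace RAM

open Function Finset
open scoped Classical

theorem Term.eval_count_congr {σ : Store} {ρ : ℕ → ℕ} {e : Term} {x m N : ℕ} {p : ℕ → Prop}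
    [DecidablePred p] (hN : m * σ 0 0 = N) (h : ∀ i < N, e.Holds σ (update ρ x i) ↔ p i) :
    (Term.count x m e).eval σ ρ = #{i ∈ range N | p i} := by
  subst hN
  rw [eval_count]
  congr 1
  exact filter_congr fun i hi => h i (mem_range.1 hi)

theorem Term.holds_ex_congr {σ : Store} {ρ : ℕ → ℕ} {e : Term} {x m N : ℕ} {p : ℕ → Prop}
    (hN : m * σ 0 0 = N) (h : ∀ i < N, e.Holds σ (update ρ x i) ↔ p i) :
    (Term.ex x m e).Holds σ ρ ↔ ∃ i < N, p i := by
  subst hN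
  rw [holds_ex]
  exact exists_congr fun i => and_congr_right fun hi => h i hi

theorem Term.holds_all_congr {σ : Store} {ρ : ℕ → ℕ} {e : Term} {x m N : ℕ} {p : ℕ → Prop}
    (hN : m * σ 0 0 = N) (h : ∀ i < N, e.Holds σ (update ρ x i) ↔ p i) :
    (Term.all x m e).Holds σ ρ ↔ ∀ i < N, p i := by
  subst hN
  rw [holds_all]
  exact forall₂_congr h

end RAM

namespace FeedbackColoring

open RAM Finset Function
open scoped Classical

/-! The arrays: 5 holds the multiples of `n`, 6 the positions in the elimination order, 7 the size
of the feedback vertex set, the number of colors that are tried, and whether to go on; 8 the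
digits that encode the guess, 9 the next digits, 10 the guessed colors on the feedback vertex set,
11 the unused colors, 12 the statuses, 13 the vertices with the extra color. -/

/-- adjacency -/
def tAdj (u v : Term) : Term := .cell 1 (.plus (.cell 5 u) v)
/-- membership in the feedback vertex set -/
def tMem (v : Term) : Term := .cell 2 v
/-- the number of available colors -/
def tColors : Term := .cell 0 (.lit 1)
/-- the allowed defect -/
def tDefect : Term := .cell 0 (.lit 2)
/-- the size of the feedback vertex set -/
def tCard : Term := .cell 7 (.lit 0)
/-- the number of colors that are tried -/
def tBase : Term := .cell 7 (.lit 1)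

/-- The memory holds the layout `L`, the number `k` of elements of the feedback vertex set, and
the numbers `b`, `χ` and `Δ`. -/
structure Ready (L : Layout) (k b χ Δ : ℕ) (σ : Store) : Prop where
  size : σ 0 0 = L.n
  colors : σ 0 1 = χ
  defect : σ 0 2 = Δ
  adj : ∀ u < L.n, ∀ v < L.n, (σ 1 (u * L.n + v) ≠ 0 ↔ L.A u v)
  mem : ∀ v < L.n, (σ 2 v ≠ 0 ↔ L.S v)
  row : ∀ u < L.n, σ 5 u = u * L.n
  pos : ∀ v < L.n, σ 6 v = L.pos v
  card : σ 7 0 = k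
  base : σ 7 1 = b

section

variable {L : Layout} {k b χ Δ : ℕ} {σ τ : Store} {ρ : ℕ → ℕ}

theorem Ready.congr (h : Ready L k b χ Δ σ) (h0 : τ 0 = σ 0) (h1 : τ 1 = σ 1) (h2 : τ 2 = σ 2)
    (h5 : τ 5 = σ 5) (h6 : τ 6 = σ 6) (h70 : τ 7 0 = σ 7 0) (h71 : τ 7 1 = σ 7 1) :
    Ready L k b χ Δ τ := by
  constructor
  · rw [h0, h.size]
  · rw [h0, h.colors]
  · rw [h0, h.defect]
  · rw [h1]; exact h.adj
  · rw [h2]; exact h.mem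
  · rw [h5]; exact h.row
  · rw [h6]; exact h.pos
  · rw [h70, h.card]
  · rw [h71, h.base]

theorem Ready.sameBut {a : ℕ} (h : Ready L k b χ Δ σ) (h' : SameBut a σ τ)
    (ha : a = 3 ∨ a = 4 ∨ 8 ≤ a) : Ready L k b χ Δ τ :=
  h.congr (h' _ (by omega)) (h' _ (by omega)) (h' _ (by omega)) (h' _ (by omega))
    (h' _ (by omega)) (by rw [h' _ (by omega)]) (by rw [h' _ (by omega)])

theorem Ready.setArray {a N : ℕ} {g : ℕ → ℕ} (h : Ready L k b χ Δ σ)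
    (ha : a = 3 ∨ a = 4 ∨ 8 ≤ a) : Ready L k b χ Δ (σ.setArray a N g) :=
  h.sameBut (fun _ hc => Store.setArray_of_ne _ _ _ hc) ha

theorem Ready.holds_adj (h : Ready L k b χ Δ σ) {u v : Term} (hu : u.eval σ ρ < L.n)
    (hv : v.eval σ ρ < L.n) : (tAdj u v).Holds σ ρ ↔ L.A (u.eval σ ρ) (v.eval σ ρ) := by
  simp only [tAdj, Term.holds_cell, Term.eval_plus, Term.eval_cell]
  rw [h.row _ hu, h.adj _ hu _ hv]

theorem Ready.holds_mem (h : Ready L k b χ Δ σ) {v : Term} (hv : v.eval σ ρ < L.n) :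
    (tMem v).Holds σ ρ ↔ L.S (v.eval σ ρ) := h.mem _ hv

theorem Ready.eval_base (h : Ready L k b χ Δ σ) : tBase.eval σ ρ = b := h.base
theorem Ready.eval_card (h : Ready L k b χ Δ σ) : tCard.eval σ ρ = k := h.card
theorem Ready.eval_defect (h : Ready L k b χ Δ σ) : tDefect.eval σ ρ = Δ := h.defect
theorem Ready.eval_colors (h : Ready L k b χ Δ σ) : tColors.eval σ ρ = χ := h.colors

theorem Ready.mul_size (h : Ready L k b χ Δ σ) (m : ℕ) : m * σ 0 0 = m * L.n := by rw [h.size]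
theorem Ready.one_size (h : Ready L k b χ Δ σ) : 1 * σ 0 0 = L.n := by rw [h.size, one_mul]

/-! #### Guessed colors on the feedback vertex set -/

namespace Layout

/-- The guessed color of a vertex of the feedback vertex set. -/
noncomputable def guess (L : Layout) (d : ℕ → ℕ) (v : ℕ) : ℕ := d #{w ∈ range L.n | w < v ∧ L.S w}

/-- The least color that does not occur in `C` among the neighbors in the feedback vertex set. -/
noncomputable def unused (L : Layout) (b : ℕ) (C : ℕ → ℕ) (v : ℕ) : ℕ :=
  leastBelow (4 * L.n) fun j => ¬ j < b ∨ ¬ ∃ s < L.n, L.S s ∧ L.A v s ∧ C s = j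

/-- The statuses that belong to a guess. -/
noncomputable def guessStatus (L : Layout) (b Δ : ℕ) (d : ℕ → ℕ) : ℕ → ℕ :=
  L.status (L.Full b (L.guess d)) Δ

/-- The coloring that belongs to a guess. -/
noncomputable def guessColor (L : Layout) (k b Δ : ℕ) (d : ℕ → ℕ) (v : ℕ) : ℕ :=
  if L.S v then L.guess d v
  else if L.guessStatus b Δ d v = 2 then
    d (k + #{w ∈ range L.n | w < v ∧ L.guessStatus b Δ d w = 2})
  else if L.Extra (L.guessStatus b Δ d) v then b
  else L.unused b (L.guess d) v

/-- The number `b` always passes the search, so the result is `b` exactly when every smaller color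
is taken. The program thus tests fullness by a comparison with `b`. -/
theorem unused_lt_iff {C : ℕ → ℕ} {v : ℕ} (hb : b < 4 * L.n) (hv : ¬ L.S v) :
    L.unused b C v < b ↔ ¬ L.Full b C v := by
  obtain ⟨h₁, h₂, h₃⟩ := leastBelow_spec (N := 4 * L.n)
    (p := fun j => ¬ j < b ∨ ¬ ∃ s < L.n, L.S s ∧ L.A v s ∧ C s = j) ⟨b, hb, .inl (lt_irrefl b)⟩
  constructor
  · rintro h ⟨-, hf⟩
    rcases h₂ with h' | h'
    · exact h' h
    · exact h' (hf _ h)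
  · intro hf
    by_contra h
    refine hf ⟨hv, fun j hj => ?_⟩
    by_contra h'
    exact h₃ j (by unfold unused at h; omega) (.inr h')

theorem unused_spec {C : ℕ → ℕ} {v : ℕ} (hb : b < 4 * L.n) (hv : ¬ L.S v)
    (hf : ¬ L.Full b C v) :
    L.unused b C v < b ∧ ∀ s < L.n, L.S s → L.A v s → C s ≠ L.unused b C v := by
  have hlt := (unused_lt_iff hb hv).2 hf
  refine ⟨hlt, fun s hs hS hA h => ?_⟩
  obtain ⟨h₁, h₂, h₃⟩ := leastBelow_spec (N := 4 * L.n)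
    (p := fun j => ¬ j < b ∨ ¬ ∃ s < L.n, L.S s ∧ L.A v s ∧ C s = j) ⟨b, hb, .inl (lt_irrefl b)⟩
  rcases h₂ with h' | h'
  · exact h' hlt
  · exact h' ⟨s, hs, hS, hA, h⟩

end Layout

/-- Write down the guessed colors of the feedback vertex set. -/
def cGuess : Cmd :=
  .fill 10 0 1 (.cell 8 (.count 1 1 (.and (.lt (.var 1) (.var 0)) (tMem (.var 1)))))

theorem Ready.exec_cGuess (h : Ready L k b χ Δ σ) :
    cGuess.exec ρ σ = σ.setArray 10 L.n (L.guess (σ 8)) := by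
  rw [← h.one_size]
  refine Cmd.exec_fill _ fun τ hτ v hv => ?_
  rw [h.one_size] at hv
  have h' := h.sameBut hτ (by omega)
  rw [Layout.guess, Term.eval_cell, hτ 8 (by omega),
    Term.eval_count_congr h'.one_size (p := fun w => w < v ∧ L.S w)]
  intro i hi
  rw [Term.holds_and, h'.holds_mem (by simpa)]
  simp

/-- Find the unused colors. -/
def cUnused : Cmd :=
  .fill 11 0 1 (.least 1 2 4 (.or (.not (.lt (.var 2) tBase))
    (.not (.ex 3 1 (.and (tMem (.var 3)) (.and (tAdj (.var 0) (.var 3))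
      (.eq (.cell 10 (.var 3)) (.var 2))))))))

theorem Ready.exec_cUnused (h : Ready L k b χ Δ σ) {C : ℕ → ℕ} (hC : ∀ v < L.n, σ 10 v = C v) :
    cUnused.exec ρ σ = σ.setArray 11 L.n (L.unused b C) := by
  rw [← h.one_size]
  refine Cmd.exec_fill _ fun τ hτ v hv => ?_
  rw [h.one_size] at hv
  have h' := h.sameBut hτ (by omega)
  rw [Layout.unused, ← h'.mul_size]
  refine Term.eval_least (by decide) fun i j hj => ?_
  rw [Term.holds_or, Term.holds_not, Term.holds_lt, h'.eval_base, Term.holds_not,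
    Term.holds_ex_congr h'.one_size (p := fun s => L.S s ∧ L.A v s ∧ C s = j)]
  · simp
  · intro s hs
    rw [Term.holds_and, Term.holds_and, h'.holds_mem (by simpa), h'.holds_adj (by simpa) (by simpa)]
    simp [hτ 10 (by omega), hC s hs]

/-! #### Statuses -/

/-- `w` is a child of `v` -/
def tChild (v w : Term) : Term :=
  .and (.not (tMem w)) (.and (tAdj v w) (.lt (.cell 6 w) (.cell 6 v)))

theorem Ready.holds_child (h : Ready L k b χ Δ σ) {v w : Term} (hv : v.eval σ ρ < L.n)
    (hw : w.eval σ ρ < L.n) :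
    (tChild v w).Holds σ ρ ↔ L.Child (v.eval σ ρ) (w.eval σ ρ) := by
  rw [tChild, Term.holds_and, Term.holds_and, Term.holds_not, h.holds_mem hw, h.holds_adj hv hw,
    Term.holds_lt, Term.eval_cell, Term.eval_cell, h.pos _ hv, h.pos _ hw, Layout.Child]
  tauto

/-- the vertex `var 0` is full or has a child whose color is guessed -/
def tForced : Term :=
  .or (.and (.not (tMem (.var 0))) (.not (.lt (.cell 11 (.var 0)) tBase)))
    (.ex 1 1 (.and (tChild (.var 0) (.var 1)) (.eq (.cell 12 (.var 1)) (.lit 2))))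

/-- the status of `var 0` -/
def tStatus : Term :=
  .ite (.lt tDefect (.plus
      (.count 1 1 (.and (tChild (.var 0) (.var 1)) (.eq (.cell 12 (.var 1)) (.lit 1))))
      (.ite tForced (.lit 1) (.lit 0))))
    (.lit 2) (.ite tForced (.lit 1) (.lit 0))

/-- Find the statuses. -/
def cStatus : Cmd := .upto 5 2 (.fill 12 0 1 tStatus)

/-- The recursion runs from children to parents, so the position serves as rank for the repeated
sweeps. -/
theorem Ready.exec_cStatus (h : Ready L k b χ Δ σ) (hL : L.IsForest) {C : ℕ → ℕ}
    (hb : b < 4 * L.n ∨ L.n = 0) (hC : ∀ v < L.n, σ 11 v = L.unused b C v) :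
    cStatus.exec ρ σ = σ.setArray 12 L.n (L.status (L.Full b C) Δ) := by
  rw [← h.one_size]
  refine Cmd.exec_upto_fill (by decide) _ L.pos (fun τ hτ t v hv hrec => ?_) fun v hv => ?_
  · rw [h.one_size] at hv hrec
    have h' := h.sameBut hτ (by omega)
    have hrec' : ∀ w, L.Child v w → τ 12 w = L.status (L.Full b C) Δ w := fun w hw =>
      hrec w hw.1 hw.2.2.2
    set ρ' := update (update ρ 5 t) 0 v with hρ'
    have h0 : ∀ i, update ρ' 1 i 0 = v := fun i => by simp [hρ']
    have hforced : tForced.Holds τ ρ' ↔ L.Forced (L.Full b C) Δ v := by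
      rw [tForced, Term.holds_or, Term.holds_and, Term.holds_not, Term.holds_not,
        h'.holds_mem (by simpa [hρ']), Term.holds_lt, h'.eval_base,
        Term.holds_ex_congr h'.one_size
          (p := fun w => L.Child v w ∧ L.status (L.Full b C) Δ w = 2), Layout.Forced]
      · have hv' : Term.eval τ (.var 0) ρ' = v := by simp [hρ']
        rw [Term.eval_cell, hv', hτ 11 (by omega), hC v hv]
        refine or_congr ?_ ?_
        · by_cases hS : L.S v
          · simp [hS, Layout.Full]
          · rw [Layout.unused_lt_iff (by omega) hS]
            simp [hS]
        · exact ⟨fun ⟨w, _, hw⟩ => ⟨w, hw⟩, fun ⟨w, hw⟩ => ⟨w, hw.1.1, hw⟩⟩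
      · intro w hw
        rw [Term.holds_and, h'.holds_child (by simpa [h0]) (by simpa)]
        simp only [Term.eval_var, h0, update_self, Term.holds_eq, Term.eval_cell, Term.eval_lit]
        exact and_congr_right fun hch => by rw [hrec' w hch]
    have hcount : Term.eval τ (.count 1 1 (.and (tChild (.var 0) (.var 1))
        (.eq (.cell 12 (.var 1)) (.lit 1)))) ρ' =
        #{w ∈ range L.n | L.Child v w ∧ L.status (L.Full b C) Δ w = 1} := by
      refine Term.eval_count_congr h'.one_size fun w hw => ?_
      rw [Term.holds_and, h'.holds_child (by simpa [h0]) (by simpa)]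
      simp only [Term.eval_var, h0, update_self, Term.holds_eq, Term.eval_cell, Term.eval_lit]
      exact and_congr_right fun hch => by rw [hrec' w hch]
    rw [L.status_eq, tStatus]
    simp only [Term.eval_ite, Term.holds_lt, Term.eval_plus, hcount, hforced, h'.eval_defect,
      Term.eval_lit]
  · rw [h.one_size] at hv
    -- Positions go up to n, so n + 1 sweeps are needed; 2n are enough because n ≥ 1 once there is a
    -- vertex.
    have := hL.pos_le hv
    rw [h.size]
    omega

/-! #### The extra color -/

/-- `w` is the parent of `v` -/
def tParent (v w : Term) : Term :=
  .and (.not (tMem w)) (.and (tAdj v w) (.lt (.cell 6 v) (.cell 6 w)))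

theorem Ready.holds_parent (h : Ready L k b χ Δ σ) {v w : Term} (hv : v.eval σ ρ < L.n)
    (hw : w.eval σ ρ < L.n) :
    (tParent v w).Holds σ ρ ↔ L.Parent (v.eval σ ρ) (w.eval σ ρ) := by
  rw [tParent, Term.holds_and, Term.holds_and, Term.holds_not, h.holds_mem hw, h.holds_adj hv hw,
    Term.holds_lt, Term.eval_cell, Term.eval_cell, h.pos _ hv, h.pos _ hw, Layout.Parent]
  tauto

/-- whether `var 0` gets the extra color -/
def tExtra : Term :=
  .ite (.and (.not (tMem (.var 0))) (.and (.not (.eq (.cell 12 (.var 0)) (.lit 2)))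
      (.or (.eq (.cell 12 (.var 0)) (.lit 1))
        (.not (.ex 1 1 (.and (tParent (.var 0) (.var 1)) (.cell 13 (.var 1))))))))
    (.lit 1) (.lit 0)

/-- Find the vertices that get the extra color. -/
def cExtra : Cmd := .upto 5 2 (.fill 13 0 1 tExtra)

/-- Here the recursion runs from parents to children, so the rank is the reversed position `L.n -
L.pos v`. -/
theorem Ready.exec_cExtra (h : Ready L k b χ Δ σ) (hL : L.IsForest) {st : ℕ → ℕ}
    (hst : ∀ v < L.n, σ 12 v = st v) :
    cExtra.exec ρ σ = σ.setArray 13 L.n fun v => if L.Extra st v then 1 else 0 := by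
  rw [← h.one_size]
  refine Cmd.exec_upto_fill (by decide) _ (fun v => L.n - L.pos v)
    (fun τ hτ t v hv hrec => ?_) fun v hv => ?_
  · rw [h.one_size] at hv hrec
    have h' := h.sameBut hτ (by omega)
    have hrec' : ∀ w, L.Parent v w → (τ 13 w ≠ 0 ↔ L.Extra st w) := fun w hw => by
      have h₁ := hw.2.2.2
      have h₂ := hL.pos_le hw.1
      rw [hrec w hw.1 (by omega)]
      split_ifs with hE <;> simp [hE]
    set ρ' := update (update ρ 5 t) 0 v with hρ'
    have h0 : ∀ i, update ρ' 1 i 0 = v := fun i => by simp [hρ']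
    have hv' : Term.eval τ (.var 0) ρ' = v := by simp [hρ']
    have hpar : (Term.ex 1 1 (.and (tParent (.var 0) (.var 1)) (.cell 13 (.var 1)))).Holds τ ρ' ↔
        ∃ w, L.Parent v w ∧ L.Extra st w := by
      rw [Term.holds_ex_congr h'.one_size (p := fun w => L.Parent v w ∧ L.Extra st w)]
      · exact ⟨fun ⟨w, _, hw⟩ => ⟨w, hw⟩, fun ⟨w, hw⟩ => ⟨w, hw.1.1, hw⟩⟩
      · intro w hw
        rw [Term.holds_and, h'.holds_parent (by simpa [h0]) (by simpa)]
        simp only [Term.eval_var, h0, update_self, Term.holds_cell]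
        exact and_congr_right fun hch => hrec' w hch
    rw [tExtra, Term.eval_ite]
    refine if_congr ?_ rfl rfl
    rw [hL.extra_iff]
    simp only [Term.holds_and, Term.holds_or, Term.holds_not, Term.holds_eq, hpar,
      Term.eval_cell, hv', Term.eval_lit, hτ 12 (by omega), hst v hv,
      h'.holds_mem (v := .var 0) (ρ := ρ') (by rwa [hv'])]
  · rw [h.one_size] at hv
    rw [h.size]
    omega

/-! #### The coloring -/

/-- Write down the coloring. -/
def cColor : Cmd :=
  .fill 4 0 1 (.ite (tMem (.var 0)) (.cell 10 (.var 0))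
    (.ite (.eq (.cell 12 (.var 0)) (.lit 2))
      (.cell 8 (.plus tCard (.count 1 1 (.and (.lt (.var 1) (.var 0))
        (.eq (.cell 12 (.var 1)) (.lit 2))))))
      (.ite (.cell 13 (.var 0)) tBase (.cell 11 (.var 0)))))

/-- Find the coloring that belongs to the digits in array 8. -/
def cPaint : Cmd := .seq cGuess (.seq cUnused (.seq cStatus (.seq cExtra cColor)))

theorem Ready.exec_cPaint (h : Ready L k b χ Δ σ) (hL : L.IsForest)
    (hb : b < 4 * L.n ∨ L.n = 0) :
    Ready L k b χ Δ (cPaint.exec ρ σ) ∧ (cPaint.exec ρ σ) 8 = σ 8 ∧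
      ∀ v < L.n, (cPaint.exec ρ σ) 4 v = L.guessColor k b Δ (σ 8) v := by
  set σ₁ := σ.setArray 10 L.n (L.guess (σ 8)) with hσ₁
  set σ₂ := σ₁.setArray 11 L.n (L.unused b (L.guess (σ 8))) with hσ₂
  set σ₃ := σ₂.setArray 12 L.n (L.guessStatus b Δ (σ 8)) with hσ₃
  set σ₄ := σ₃.setArray 13 L.n
    (fun v => if L.Extra (L.guessStatus b Δ (σ 8)) v then 1 else 0) with hσ₄
  set σ₅ := σ₄.setArray 4 L.n (L.guessColor k b Δ (σ 8)) with hσ₅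
  have h₁ : Ready L k b χ Δ σ₁ := h.setArray (by omega)
  have h₂ : Ready L k b χ Δ σ₂ := h₁.setArray (by omega)
  have h₃ : Ready L k b χ Δ σ₃ := h₂.setArray (by omega)
  have h₄ : Ready L k b χ Δ σ₄ := h₃.setArray (by omega)
  have h₅ : Ready L k b χ Δ σ₅ := h₄.setArray (by omega)
  have e₁ : cGuess.exec ρ σ = σ₁ := h.exec_cGuess
  have e₂ : cUnused.exec ρ σ₁ = σ₂ := h₁.exec_cUnused fun v hv => Store.setArray_of_lt _ _ hv
  have e₃ : cStatus.exec ρ σ₂ = σ₃ :=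
    h₂.exec_cStatus hL hb fun v hv => Store.setArray_of_lt _ _ hv
  have e₄ : cExtra.exec ρ σ₃ = σ₄ := h₃.exec_cExtra hL fun v hv => Store.setArray_of_lt _ _ hv
  have e₅ : cColor.exec ρ σ₄ = σ₅ := by
    rw [hσ₅, ← h₄.one_size]
    refine Cmd.exec_fill _ fun τ hτ v hv => ?_
    rw [h₄.one_size] at hv
    have h' := h₄.sameBut hτ (by omega)
    have a8 : τ 8 = σ 8 := by
      rw [hτ 8 (by omega), hσ₄, hσ₃, hσ₂, hσ₁]
      simp [Store.setArray_of_ne]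
    have a10 : τ 10 v = L.guess (σ 8) v := by
      rw [hτ 10 (by omega), hσ₄, hσ₃, hσ₂, Store.setArray_of_ne _ _ _ (by omega),
        Store.setArray_of_ne _ _ _ (by omega), Store.setArray_of_ne _ _ _ (by omega), hσ₁,
        Store.setArray_of_lt _ _ hv]
    have a11 : τ 11 v = L.unused b (L.guess (σ 8)) v := by
      rw [hτ 11 (by omega), hσ₄, hσ₃, Store.setArray_of_ne _ _ _ (by omega),
        Store.setArray_of_ne _ _ _ (by omega), hσ₂, Store.setArray_of_lt _ _ hv]
    have a12 : ∀ w < L.n, τ 12 w = L.guessStatus b Δ (σ 8) w := fun w hw => by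
      rw [hτ 12 (by omega), hσ₄, Store.setArray_of_ne _ _ _ (by omega), hσ₃,
        Store.setArray_of_lt _ _ hw]
    have a13 : τ 13 v ≠ 0 ↔ L.Extra (L.guessStatus b Δ (σ 8)) v := by
      rw [hτ 13 (by omega), hσ₄, Store.setArray_of_lt _ _ hv]
      split_ifs with hE <;> simp [hE]
    have hv' : Term.eval τ (.var 0) (update ρ 0 v) = v := by simp
    have hcount : Term.eval τ (.count 1 1 (.and (.lt (.var 1) (.var 0))
        (.eq (.cell 12 (.var 1)) (.lit 2)))) (update ρ 0 v) =
        #{w ∈ range L.n | w < v ∧ L.guessStatus b Δ (σ 8) w = 2} := by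
      refine Term.eval_count_congr h'.one_size fun w hw => ?_
      simp [a12 w hw]
    simp only [Term.eval_ite, Layout.guessColor, hcount, Term.eval_plus, Term.eval_cell, hv',
      h'.eval_card, h'.eval_base, a8, a10, a11, Term.holds_eq, a12 v hv, Term.eval_lit,
      Term.holds_cell, a13, h'.holds_mem (v := .var 0) (ρ := update ρ 0 v) (by rwa [hv'])]
  have e : cPaint.exec ρ σ = σ₅ := by
    rw [cPaint, Cmd.exec, e₁, Cmd.exec, e₂, Cmd.exec, e₃, Cmd.exec, e₄, e₅]
  rw [e]
  refine ⟨h₅, ?_, fun v hv => Store.setArray_of_lt _ _ hv⟩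
  rw [hσ₅, hσ₄, hσ₃, hσ₂, hσ₁]
  simp [Store.setArray_of_ne]

end

end FeedbackColoring

/-! ### Enumerating the guesses -/

namespace FeedbackColoring

open RAM Finset Function
open scoped Classical

theorem succ_mod_eq {b : ℕ} (hb : 0 < b) (x : ℕ) :
    (x + 1) % b = if x % b + 1 < b then x % b + 1 else 0 := by
  rw [Nat.add_mod_eq_ite]
  rcases Nat.lt_or_ge 1 b with h | h
  · rw [Nat.mod_eq_of_lt h]
    have := Nat.mod_lt x hb
    split_ifs <;> omega
  · obtain rfl : b = 1 := by omega
    simp [Nat.mod_one]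

/-- The carry rule: adding 1 carries into digit `i` exactly when all lower digits are maximal. -/
theorem pow_dvd_succ_iff {b : ℕ} (hb : 0 < b) (m i : ℕ) :
    b ^ i ∣ m + 1 ↔ ∀ j < i, m / b ^ j % b + 1 = b := by
  induction i with
  | zero => simp
  | succ i ih =>
    rw [Nat.forall_lt_succ_right, ← ih]
    constructor
    · intro h
      have h₁ : b ^ i ∣ m + 1 := (pow_dvd_pow b (Nat.le_succ i)).trans h
      refine ⟨h₁, ?_⟩
      have h₂ : b ∣ m / b ^ i + 1 := by
        have := Nat.succ_div (a := m) (b := b ^ i)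
        rw [if_pos h₁] at this
        rw [← this]
        exact Nat.dvd_div_of_mul_dvd (by rwa [← pow_succ])
      have h₃ := Nat.mod_eq_zero_of_dvd h₂
      rw [succ_mod_eq hb] at h₃
      have := Nat.mod_lt (m / b ^ i) hb
      split_ifs at h₃
      omega
    · rintro ⟨h₁, h₂⟩
      have h₃ : (m / b ^ i + 1) % b = 0 := by
        rw [succ_mod_eq hb, if_neg (by omega)]
      have := Nat.succ_div (a := m) (b := b ^ i)
      rw [if_pos h₁] at this
      rw [← this] at h₃
      rw [pow_succ]
      obtain ⟨c, hc⟩ := Nat.dvd_of_mod_eq_zero h₃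
      exact ⟨c, by rw [mul_assoc, ← hc, Nat.mul_div_cancel' h₁]⟩

theorem succ_div_pow_mod {b : ℕ} (hb : 0 < b) (m i : ℕ) :
    (m + 1) / b ^ i % b = if ∀ j < i, m / b ^ j % b + 1 = b then
      (if m / b ^ i % b + 1 < b then m / b ^ i % b + 1 else 0) else m / b ^ i % b := by
  simp only [Nat.succ_div, ← pow_dvd_succ_iff hb]
  split_ifs with h₁ h₂
  · rw [succ_mod_eq hb, if_pos h₂]
  · rw [succ_mod_eq hb, if_neg h₂]
  · simp

/-- The first `N` digits of `m` to the base `b`. -/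
def digits (b N m i : ℕ) : ℕ := if i < N then m / b ^ i % b else 0

theorem exists_digits_eq {b N K : ℕ} {d : ℕ → ℕ} (hb : 0 < b) (hK : K ≤ N)
    (hd : ∀ i < K, d i < b) (h0 : ∀ i, K ≤ i → d i = 0) : ∃ m < b ^ K, digits b N m = d := by
  have key : ∀ K, (∀ i < K, d i < b) → ∃ m < b ^ K, ∀ i < K, m / b ^ i % b = d i := by
    intro K hd
    induction K with
    | zero => exact ⟨0, by simp⟩
    | succ K ih =>
      obtain ⟨m, hm, h⟩ := ih fun i hi => hd i (by omega)
      refine ⟨m + b ^ K * d K, ?_, fun i hi => ?_⟩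
      · have h₁ := hd K (Nat.lt_succ_self K)
        calc m + b ^ K * d K < b ^ K + b ^ K * d K := by omega
          _ = b ^ K * (d K + 1) := by ring
          _ ≤ b ^ K * b := Nat.mul_le_mul_left _ h₁
          _ = b ^ (K + 1) := (pow_succ b K).symm
      · rcases Nat.lt_succ_iff_lt_or_eq.1 hi with hi | rfl
        · obtain ⟨c, rfl⟩ : ∃ c, K = i + 1 + c := ⟨K - (i + 1), by omega⟩
          have : b ^ (i + 1 + c) * d (i + 1 + c) = b ^ i * (b * (b ^ c * d (i + 1 + c))) := by ring
          rw [this, Nat.add_mul_div_left _ _ (pow_pos hb i), Nat.add_mul_mod_self_left, h i hi]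
        · rw [Nat.add_mul_div_left _ _ (pow_pos hb i), Nat.div_eq_of_lt hm, zero_add,
            Nat.mod_eq_of_lt (hd i (Nat.lt_succ_self i))]
  obtain ⟨m, hm, h⟩ := key K hd
  refine ⟨m, hm, funext fun i => ?_⟩
  unfold digits
  rcases Nat.lt_or_ge i K with hi | hi
  · rw [if_pos (by omega), h i hi]
  · rw [h0 i hi, Nat.div_eq_of_lt (hm.trans_le (Nat.pow_le_pow_right hb hi)), Nat.zero_mod, ite_self]

/-- A coloring with colors up to `χ` and defect at most `Δ`. -/
def Layout.Good (L : Layout) (χ Δ : ℕ) (col : ℕ → ℕ) : Prop :=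
  ∀ v < L.n, ¬ χ < col v ∧ ¬ Δ < #{w ∈ range L.n | L.A v w ∧ col w = col v}

theorem Layout.Good.congr {L : Layout} {χ Δ : ℕ} {col col' : ℕ → ℕ} (h : L.Good χ Δ col)
    (he : ∀ v < L.n, col' v = col v) : L.Good χ Δ col' := fun v hv => by
  rw [he v hv, filter_congr fun w hw => by rw [he w (mem_range.1 hw)]]
  exact h v hv

/-! ### Testing a guess and passing to the next one -/

/-- whether the coloring is good -/
def tGood : Term :=
  .all 0 1 (.and (.not (.lt tColors (.cell 4 (.var 0))))
    (.not (.lt tDefect (.count 1 1 (.and (tAdj (.var 0) (.var 1))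
      (.eq (.cell 4 (.var 1)) (.cell 4 (.var 0))))))))

/-- whether there are more guesses -/
def tMore : Term :=
  .ex 0 2 (.and (.lt (.var 0) (.plus tCard tCard))
    (.lt (.plus (.cell 8 (.var 0)) (.lit 1)) tBase))

/-- Write down whether the coloring is good, and whether to go on. -/
def cVerdict : Cmd :=
  .seq (.write 3 (.lit 0) tGood)
    (.write 7 (.lit 2) (.ite (.cell 3 (.lit 0)) (.lit 0) (.ite tMore (.lit 1) (.lit 0))))

/-- Write down the digits of the next guess. -/
def cNext : Cmd :=
  .seq
    (.fill 9 0 2 (.ite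
      (.all 1 2 (.or (.not (.lt (.var 1) (.var 0)))
        (.eq (.plus (.cell 8 (.var 1)) (.lit 1)) tBase)))
      (.ite (.lt (.plus (.cell 8 (.var 0)) (.lit 1)) tBase)
        (.plus (.cell 8 (.var 0)) (.lit 1)) (.lit 0))
      (.cell 8 (.var 0))))
    (.fill 8 0 2 (.cell 9 (.var 0)))

/-- Try one guess and prepare the next one. -/
def cStep : Cmd := .seq cPaint (.seq cVerdict cNext)

variable {L : Layout} {k b χ Δ m : ℕ} {σ : Store} {ρ : ℕ → ℕ}

theorem Ready.holds_tGood (h : Ready L k b χ Δ σ) : tGood.Holds σ ρ ↔ L.Good χ Δ (σ 4) := by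
  refine Term.holds_all_congr h.one_size fun v hv => ?_
  have hcount : Term.eval σ (.count 1 1 (.and (tAdj (.var 0) (.var 1))
      (.eq (.cell 4 (.var 1)) (.cell 4 (.var 0))))) (update ρ 0 v) =
      #{w ∈ range L.n | L.A v w ∧ σ 4 w = σ 4 v} := by
    refine Term.eval_count_congr h.one_size fun w hw => ?_
    rw [Term.holds_and, h.holds_adj (by simpa) (by simpa)]
    simp
  simp only [Term.holds_and, Term.holds_not, Term.holds_lt, hcount, h.eval_defect, h.eval_colors,
    Term.eval_cell, Term.eval_var, update_self]

theorem Ready.holds_tMore (h : Ready L k b χ Δ σ) (hb : 0 < b) (hk : k ≤ L.n)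
    (hm : m < b ^ (2 * k)) (h8 : σ 8 = digits b (2 * L.n) m) :
    tMore.Holds σ ρ ↔ m + 1 ≠ b ^ (2 * k) := by
  rw [tMore, Term.holds_ex_congr (h.mul_size 2)
    (p := fun i => i < 2 * k ∧ m / b ^ i % b + 1 < b)]
  · have h₁ : m + 1 = b ^ (2 * k) ↔ b ^ (2 * k) ∣ m + 1 :=
      ⟨fun h => h ▸ dvd_rfl, fun h => le_antisymm hm (Nat.le_of_dvd (Nat.succ_pos m) h)⟩
    rw [Ne, h₁, pow_dvd_succ_iff hb]
    push Not
    constructor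
    · rintro ⟨i, -, hi, h⟩
      exact ⟨i, hi, h.ne⟩
    · rintro ⟨i, hi, h⟩
      have := Nat.mod_lt (m / b ^ i) hb
      exact ⟨i, by omega, hi, by omega⟩
  · intro i hi
    simp only [Term.holds_and, Term.holds_lt, Term.eval_plus, h.eval_card, h.eval_base,
      Term.eval_cell, Term.eval_var, update_self, Term.eval_lit, h8, digits, if_pos hi]
    rw [two_mul]

theorem Ready.exec_cVerdict (h : Ready L k b χ Δ σ) (hb : 0 < b) (hk : k ≤ L.n)
    (hm : m < b ^ (2 * k)) (h8 : σ 8 = digits b (2 * L.n) m) :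
    Ready L k b χ Δ (cVerdict.exec ρ σ) ∧ (cVerdict.exec ρ σ) 8 = σ 8 ∧
      (cVerdict.exec ρ σ) 4 = σ 4 ∧
      (cVerdict.exec ρ σ 3 0 = 1 ∧ cVerdict.exec ρ σ 7 2 = 0 ∧ L.Good χ Δ (σ 4) ∨
        cVerdict.exec ρ σ 3 0 = 0 ∧ ¬ L.Good χ Δ (σ 4) ∧
          (cVerdict.exec ρ σ 7 2 = 0 ↔ m + 1 = b ^ (2 * k))) := by
  set v := tGood.eval σ ρ with hv
  set σ₁ := σ.write 3 0 v with hσ₁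
  have h₁ : Ready L k b χ Δ σ₁ := h.sameBut (fun c hc => Store.write_of_ne _ _ _ hc) (.inl rfl)
  set u := Term.eval σ₁ (.ite (.cell 3 (.lit 0)) (.lit 0) (.ite tMore (.lit 1) (.lit 0))) ρ with hu
  have e : cVerdict.exec ρ σ = σ₁.write 7 2 u := rfl
  have hgood : tGood.Holds σ ρ ↔ L.Good χ Δ (σ 4) := h.holds_tGood
  have hmore : tMore.Holds σ₁ ρ ↔ m + 1 ≠ b ^ (2 * k) :=
    h₁.holds_tMore hb hk hm (by rw [hσ₁, Store.write_of_ne _ _ _ (by omega), h8])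
  have h30 : σ₁ 3 0 = v := by simp [hσ₁, Store.write_apply]
  have h30' : (σ₁.write 7 2 u) 3 0 = v := by simp [hσ₁, Store.write_apply]
  have h72 : (σ₁.write 7 2 u) 7 2 = u := by simp [Store.write_apply]
  rw [e]
  refine ⟨h₁.congr ?_ ?_ ?_ ?_ ?_ ?_ ?_, ?_, ?_, ?_⟩
  · exact Store.write_of_ne _ _ _ (by omega)
  · exact Store.write_of_ne _ _ _ (by omega)
  · exact Store.write_of_ne _ _ _ (by omega)
  · exact Store.write_of_ne _ _ _ (by omega)
  · exact Store.write_of_ne _ _ _ (by omega)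
  · simp [Store.write_apply]
  · simp [Store.write_apply]
  · rw [Store.write_of_ne _ _ _ (by omega), hσ₁, Store.write_of_ne _ _ _ (by omega)]
  · rw [Store.write_of_ne _ _ _ (by omega), hσ₁, Store.write_of_ne _ _ _ (by omega)]
  · rw [h30', h72]
    have hv' : v = if tGood.Holds σ ρ then 1 else 0 := Term.eval_all _ _ _ _ _
    rw [Term.eval_ite, Term.holds_cell, Term.eval_lit, h30, Term.eval_ite, hmore] at hu
    by_cases hg : L.Good χ Δ (σ 4)
    · rw [if_pos (hgood.2 hg)] at hv'
      left
      refine ⟨hv', ?_, hg⟩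
      rw [hu, hv', if_pos one_ne_zero]
    · rw [if_neg (mt hgood.1 hg)] at hv'
      right
      refine ⟨hv', hg, ?_⟩
      rw [hu, hv', if_neg (by simp)]
      by_cases hm' : m + 1 = b ^ (2 * k) <;> simp [hm']

theorem Ready.exec_cNext (h : Ready L k b χ Δ σ) (hb : 0 < b)
    (h8 : σ 8 = digits b (2 * L.n) m) :
    Ready L k b χ Δ (cNext.exec ρ σ) ∧ (cNext.exec ρ σ) 8 = digits b (2 * L.n) (m + 1) ∧
      (cNext.exec ρ σ) 3 = σ 3 ∧ (cNext.exec ρ σ) 4 = σ 4 ∧ (cNext.exec ρ σ) 7 = σ 7 := by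
  set D := digits b (2 * L.n) (m + 1) with hD
  set σ₁ := σ.setArray 9 (2 * L.n) D with hσ₁
  set σ₂ := σ₁.setArray 8 (2 * L.n) D with hσ₂
  have h₁ : Ready L k b χ Δ σ₁ := h.setArray (by omega)
  have h₂ : Ready L k b χ Δ σ₂ := h₁.setArray (by omega)
  have e : cNext.exec ρ σ = σ₂ := by
    -- The new digits go to array 9 first, so that every carry is read off from the old digits.
    have e₁ : (Cmd.fill 9 0 2 (.ite
        (.all 1 2 (.or (.not (.lt (.var 1) (.var 0)))
          (.eq (.plus (.cell 8 (.var 1)) (.lit 1)) tBase)))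
        (.ite (.lt (.plus (.cell 8 (.var 0)) (.lit 1)) tBase)
          (.plus (.cell 8 (.var 0)) (.lit 1)) (.lit 0))
        (.cell 8 (.var 0)))).exec ρ σ = σ₁ := by
      rw [hσ₁, ← h.mul_size]
      refine Cmd.exec_fill _ fun τ hτ v hv => ?_
      rw [h.mul_size] at hv
      have h' := h.sameBut hτ (by omega)
      have hτ8 : ∀ i < 2 * L.n, τ 8 i = m / b ^ i % b := fun i hi => by
        rw [hτ 8 (by omega), h8, digits, if_pos hi]
      have hall : (Term.all 1 2 (.or (.not (.lt (.var 1) (.var 0)))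
          (.eq (.plus (.cell 8 (.var 1)) (.lit 1)) tBase))).Holds τ (update ρ 0 v) ↔
          ∀ j < v, m / b ^ j % b + 1 = b := by
        rw [Term.holds_all_congr (h'.mul_size 2)
          (p := fun j => ¬ j < v ∨ m / b ^ j % b + 1 = b)]
        · exact ⟨fun h j hj => (h j (by omega)).resolve_left (by simpa),
            fun h j _ => or_iff_not_imp_left.2 fun hj => h j (by simpa using hj)⟩
        · intro j hj
          simp only [Term.holds_or, Term.holds_not, Term.holds_lt, Term.holds_eq, h'.eval_base,
            Term.eval_plus, Term.eval_cell, Term.eval_var, update_self, Term.eval_lit, hτ8 j hj]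
          simp
      simp only [Term.eval_ite, hall, Term.holds_lt, h'.eval_base, Term.eval_plus, Term.eval_cell,
        Term.eval_var, update_self, Term.eval_lit, hτ8 v hv, hD, digits, if_pos hv,
        succ_div_pow_mod hb]
    have e₂ : (Cmd.fill 8 0 2 (.cell 9 (.var 0))).exec ρ σ₁ = σ₂ := by
      rw [hσ₂, ← h₁.mul_size]
      refine Cmd.exec_fill _ fun τ hτ v hv => ?_
      rw [h₁.mul_size] at hv
      rw [Term.eval_cell, Term.eval_var, update_self, hτ 9 (by omega), hσ₁,
        Store.setArray_of_lt _ _ hv]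
    rw [cNext, Cmd.exec, e₁, e₂]
  rw [e]
  refine ⟨h₂, funext fun i => ?_, ?_, ?_, ?_⟩
  · by_cases hi : i < 2 * L.n
    · rw [hσ₂, Store.setArray_of_lt _ _ hi]
    · rw [hσ₂, Store.setArray, update_self, if_neg hi, hσ₁, Store.setArray_of_ne _ _ _ (by omega),
        h8, hD, digits, digits, if_neg hi, if_neg hi]
  all_goals
    rw [hσ₂, hσ₁, Store.setArray_of_ne _ _ _ (by omega), Store.setArray_of_ne _ _ _ (by omega)]

/-- The `m`-th guess gives a good coloring. -/
def Layout.GoodGuess (L : Layout) (k b χ Δ m : ℕ) : Prop :=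
  L.Good χ Δ (L.guessColor k b Δ (digits b (2 * L.n) m))

theorem Ready.exec_cStep (h : Ready L k b χ Δ σ) (hL : L.IsForest) (hb : 0 < b)
    (hb' : b < 4 * L.n ∨ L.n = 0) (hk : k ≤ L.n) (hm : m < b ^ (2 * k))
    (h8 : σ 8 = digits b (2 * L.n) m) :
    Ready L k b χ Δ (cStep.exec ρ σ) ∧ (cStep.exec ρ σ) 8 = digits b (2 * L.n) (m + 1) ∧
      (cStep.exec ρ σ 3 0 = 1 ∧ cStep.exec ρ σ 7 2 = 0 ∧ L.Good χ Δ (cStep.exec ρ σ 4) ∨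
        cStep.exec ρ σ 3 0 = 0 ∧ ¬ L.GoodGuess k b χ Δ m ∧
          (cStep.exec ρ σ 7 2 = 0 ↔ m + 1 = b ^ (2 * k))) := by
  obtain ⟨h₁, h₁8, h₁4⟩ := h.exec_cPaint (ρ := ρ) hL hb'
  rw [h8] at h₁8
  obtain ⟨h₂, h₂8, h₂4, hv⟩ := h₁.exec_cVerdict (ρ := ρ) hb hk hm h₁8
  rw [h₁8] at h₂8
  obtain ⟨h₃, h₃8, h₃3, h₃4, h₃7⟩ := h₂.exec_cNext (ρ := ρ) hb h₂8
  have e : cStep.exec ρ σ = cNext.exec ρ (cVerdict.exec ρ (cPaint.exec ρ σ)) := rfl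
  rw [e]
  refine ⟨h₃, h₃8, ?_⟩
  rw [h₃3, h₃7, h₃4, h₂4]
  refine hv.imp_right fun ⟨h₁, h₂, h₃⟩ => ⟨h₁, fun hg => h₂ ?_, h₃⟩
  rw [Layout.GoodGuess, ← h8] at hg
  exact hg.congr h₁4

end FeedbackColoring

/-! ### Completeness of the enumeration -/

namespace FeedbackColoring

open RAM Finset Function
open scoped Classical

/-- Values at the elements of a set can be read off at their ranks. -/
theorem exists_rank_function {n b : ℕ} (p : ℕ → Prop) [DecidablePred p] (g : ℕ → ℕ) (hb : 0 < b)
    (hg : ∀ v < n, g v < b) :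
    ∃ d : ℕ → ℕ, (∀ v < n, p v → d #{w ∈ range n | w < v ∧ p w} = g v) ∧ (∀ i, d i < b) ∧
      ∀ i, #{w ∈ range n | p w} ≤ i → d i = 0 := by
  set r : ℕ → ℕ := fun v => #{w ∈ range n | w < v ∧ p w} with hr
  have hlt : ∀ u v, u < n → p u → u < v → r u < r v := fun u v hu hpu huv =>
    card_lt_card <| (ssubset_iff_of_subset fun w hw => by
        simp only [mem_filter] at hw ⊢
        exact ⟨hw.1, hw.2.1.trans huv, hw.2.2⟩).2
      ⟨u, mem_filter.2 ⟨mem_range.2 hu, huv, hpu⟩, by simp⟩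
  have hinj : ∀ u v, u < n → v < n → p u → p v → r u = r v → u = v := fun u v hu hv hpu hpv h => by
    rcases lt_trichotomy u v with h' | h' | h'
    · exact absurd h (hlt u v hu hpu h').ne
    · exact h'
    · exact absurd h (hlt v u hv hpv h').ne'
  have hcard : ∀ v, v < n → p v → r v < #{w ∈ range n | p w} := fun v hv hpv =>
    card_lt_card <| (ssubset_iff_of_subset fun w hw => by
        simp only [mem_filter] at hw ⊢
        exact ⟨hw.1, hw.2.2⟩).2
      ⟨v, mem_filter.2 ⟨mem_range.2 hv, hpv⟩, by simp⟩
  refine ⟨fun i => if h : ∃ v, v < n ∧ p v ∧ r v = i then g h.choose else 0,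
    fun v hv hpv => ?_, fun i => ?_, fun i hi => ?_⟩
  · have h : ∃ v', v' < n ∧ p v' ∧ r v' = r v := ⟨v, hv, hpv, rfl⟩
    have hc := h.choose_spec
    change (if h : ∃ v', v' < n ∧ p v' ∧ r v' = r v then g h.choose else 0) = g v
    rw [dif_pos h, hinj _ v hc.1 hv hc.2.1 hpv hc.2.2]
  · dsimp only
    split_ifs with h
    · exact hg _ h.choose_spec.1
    · exact hb
  · refine dif_neg ?_
    rintro ⟨v, hv, hpv, rfl⟩
    exact absurd (hcard v hv hpv) (not_lt.2 hi)

namespace Layout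

variable {L : Layout} {b : ℕ} {C g : ℕ → ℕ}

/-- Fullness, and with it every status, depends only on the colors on `S`. So the program can find
which vertices are guessed before it knows their colors. -/
theorem full_congr (h : ∀ v < L.n, L.S v → C v = g v) : L.Full b C = L.Full b g := by
  funext v
  refine propext (and_congr_right fun _ => forall₂_congr fun j _ => ?_)
  refine exists_congr fun s => and_congr_right fun hs => and_congr_right fun hS => ?_
  rw [h s hs hS]

theorem unused_congr (h : ∀ v < L.n, L.S v → C v = g v) : L.unused b C = L.unused b g := by
  funext v
  refine leastBelow_congr fun j _ => or_congr_right (not_congr ?_)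
  refine exists_congr fun s => and_congr_right fun hs => and_congr_right fun hS => ?_
  rw [h s hs hS]

theorem unused_le {v : ℕ} (hb : b < 4 * L.n) : L.unused b C v ≤ b := by
  by_contra h
  exact (leastBelow_spec (N := 4 * L.n)
    (p := fun j => ¬ j < b ∨ ¬ ∃ s < L.n, L.S s ∧ L.A v s ∧ C s = j)
    ⟨b, hb, .inl (lt_irrefl b)⟩).2.2 b (not_le.1 h) (.inl (lt_irrefl b))

/-- If there is a coloring of defect at most `Δ` with `b` colors, then some guess gives a good
coloring. -/
theorem IsForest.exists_goodGuess (hL : L.IsForest) {k χ Δ : ℕ} (hb : 0 < b)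
    (hb' : b < 4 * L.n ∨ L.n = 0) (hχ : b ≤ χ) (hk : #{v ∈ range L.n | L.S v} = k)
    (hg : ∀ v < L.n, g v < b)
    (hd : ∀ v < L.n, #{w ∈ range L.n | L.A v w ∧ g w = g v} ≤ Δ) :
    ∃ m < b ^ (2 * k), L.GoodGuess k b χ Δ m := by
  have hkn : k ≤ L.n := by
    rw [← hk]
    exact (card_filter_le _ _).trans (card_range _).le
  set st := L.status (L.Full b g) Δ with hst
  obtain ⟨d₁, h₁, h₁b, h₁0⟩ := exists_rank_function L.S g hb hg
  obtain ⟨d₂, h₂, h₂b, h₂0⟩ := exists_rank_function (fun v => st v = 2) g hb hg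
  have hH : #{v ∈ range L.n | st v = 2} ≤ k := hk ▸ hL.card_guessed_le hg hd
  -- The first k digits list the colors on `S` by rank, the next k those of the guessed vertices by
  -- rank, padded with zeros.
  obtain ⟨m, hm, hdig⟩ := exists_digits_eq (b := b) (N := 2 * L.n) (K := 2 * k)
    (d := fun i => if i < k then d₁ i else d₂ (i - k)) hb (by omega)
    (fun i _ => by
      split_ifs
      exacts [h₁b i, h₂b _])
    (fun i hi => by
      rw [if_neg (by omega)]
      exact h₂0 _ (by omega))
  refine ⟨m, hm, ?_⟩
  rw [GoodGuess, hdig]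
  set d : ℕ → ℕ := fun i => if i < k then d₁ i else d₂ (i - k) with hd_def
  have hguess : ∀ v < L.n, L.S v → L.guess d v = g v := fun v hv hS => by
    have : #{w ∈ range L.n | w < v ∧ L.S w} < k := by
      rw [← hk]
      refine card_lt_card <| (ssubset_iff_of_subset fun w hw => ?_).2
        ⟨v, mem_filter.2 ⟨mem_range.2 hv, hS⟩, by simp⟩
      simp only [mem_filter] at hw ⊢
      exact ⟨hw.1, hw.2.2⟩
    rw [guess, hd_def]
    dsimp only
    rw [if_pos this, h₁ v hv hS]
  have hstatus : L.guessStatus b Δ d = st := by rw [guessStatus, full_congr hguess]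
  have hcol : ∀ v < L.n, L.guessColor k b Δ d v = L.color b st g (L.unused b g) v := by
    intro v hv
    rw [guessColor, color, hstatus, unused_congr hguess]
    by_cases hS : L.S v
    · rw [if_pos hS, if_pos (.inl hS), hguess v hv hS]
    · rw [if_neg hS]
      by_cases h2 : st v = 2
      · rw [if_pos h2, if_pos (.inr h2), ← h₂ v hv h2, hd_def]
        dsimp only
        rw [if_neg (by omega), Nat.add_sub_cancel_left]
      · rw [if_neg h2, if_neg (not_or.2 ⟨hS, h2⟩)]
  refine Good.congr (fun v hv => ?_) hcol
  have hb'' : b < 4 * L.n := by omega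
  refine ⟨not_lt.2 ?_, not_lt.2 (hL.card_color_le hg hd
    (fun v _ hS hf => unused_spec hb'' hS hf) v hv)⟩
  rw [color]
  split_ifs
  · exact (hg v hv).le.trans hχ
  · exact hχ
  · exact (unused_le hb'').trans hχ

end Layout

/-! ### The elimination order -/

/-- `var 1` is a remaining vertex of the forest with at most one remaining neighbor -/
def tCandidate : Term :=
  .and (.not (tMem (.var 1))) (.and (.not (.cell 6 (.var 1)))
    (.not (.lt (.lit 1) (.count 2 1 (.and (.not (tMem (.var 2)))
      (.and (.not (.cell 6 (.var 2))) (tAdj (.var 1) (.var 2))))))))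

/-- Find an elimination order. -/
def cEliminate : Cmd :=
  .upto 4 1 (.write 6 (.least 0 1 1 tCandidate) (.plus (.var 4) (.lit 1)))

variable {L : Layout} {k b χ Δ : ℕ} {σ : Store} {ρ : ℕ → ℕ}

theorem Ready.withPos {τ : Store} (h : Ready L k b χ Δ σ) (h' : SameBut 6 σ τ) :
    Ready { L with pos := τ 6 } k b χ Δ τ := by
  constructor
  · rw [h' 0 (by omega)]; exact h.size
  · rw [h' 0 (by omega)]; exact h.colors
  · rw [h' 0 (by omega)]; exact h.defect
  · rw [h' 1 (by omega)]; exact h.adj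
  · rw [h' 2 (by omega)]; exact h.mem
  · rw [h' 5 (by omega)]; exact h.row
  · exact fun v _ => rfl
  · rw [h' 7 (by omega)]; exact h.card
  · rw [h' 7 (by omega)]; exact h.base

/-- The remaining vertices of the forest with at most one remaining neighbor. -/
def Layout.Candidate (L : Layout) (v : ℕ) : Prop :=
  ¬ L.S v ∧ L.pos v = 0 ∧ #{w ∈ range L.n | ¬ L.S w ∧ L.pos w = 0 ∧ L.A v w} ≤ 1

theorem Ready.eval_least_tCandidate (h : Ready L k b χ Δ σ) :
    (Term.least 0 1 1 tCandidate).eval σ ρ = leastBelow L.n L.Candidate := by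
  rw [← h.one_size]
  refine Term.eval_least (by decide) fun i v hv => ?_
  rw [h.one_size] at hv
  have hcount : Term.eval σ (.count 2 1 (.and (.not (tMem (.var 2)))
      (.and (.not (.cell 6 (.var 2))) (tAdj (.var 1) (.var 2))))) (update (update ρ 0 i) 1 v) =
      #{w ∈ range L.n | ¬ L.S w ∧ L.pos w = 0 ∧ L.A v w} := by
    refine Term.eval_count_congr h.one_size fun w hw => ?_
    rw [Term.holds_and, Term.holds_and, Term.holds_not, Term.holds_not,
      h.holds_mem (by simpa), h.holds_adj (by simpa) (by simpa)]
    simp [h.pos w hw]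
  rw [tCandidate, Term.holds_and, Term.holds_and, Term.holds_not, Term.holds_not, Term.holds_not,
    Term.holds_lt, hcount, h.holds_mem (by simpa), Layout.Candidate]
  simp [h.pos v hv]

/-- The vertices with nonzero position have been eliminated in the first `t` steps. -/
structure Layout.Eliminated (L : Layout) (t : ℕ) : Prop where
  pos_le : ∀ v < L.n, L.pos v ≤ t
  pos_of_mem : ∀ v < L.n, L.S v → L.pos v = 0
  pos_inj : ∀ u < L.n, ∀ v < L.n, L.pos u ≠ 0 → L.pos u = L.pos v → u = v
  card_later : ∀ v < L.n, L.pos v ≠ 0 →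
    #{w ∈ range L.n | ¬ L.S w ∧ L.A v w ∧ (L.pos w = 0 ∨ L.pos v < L.pos w)} ≤ 1
  progress : (∀ v < L.n, ¬ L.S v → L.pos v ≠ 0) ∨ t ≤ #{v ∈ range L.n | L.pos v ≠ 0}

/-- The new position exceeds all earlier ones, so the later neighbors of `v` are its remaining
neighbors, at most one by candidacy. For vertices eliminated before, `v` counted as later already
while its position was 0. -/
theorem Layout.Eliminated.step {t v : ℕ} (h : L.Eliminated t) (hv : v < L.n)
    (hc : L.Candidate v) : ({ L with pos := update L.pos v (t + 1) } : Layout).Eliminated (t + 1) := by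
  obtain ⟨hS, h0, hcard⟩ := hc
  constructor
  · intro u hu
    have := h.pos_le u hu
    by_cases huv : u = v
    · simp [huv]
    · simp only [update_of_ne huv]
      omega
  · intro u hu hSu
    have : u ≠ v := fun h => hS (h ▸ hSu)
    simp only [update_of_ne this]
    exact h.pos_of_mem u hu hSu
  · intro u hu w hw hu0 he
    have h₁ := h.pos_le u hu
    have h₂ := h.pos_le w hw
    by_cases huv : u = v <;> by_cases hwv : w = v
    · rw [huv, hwv]
    · subst huv
      simp only [update_self, update_of_ne hwv] at he
      omega
    · subst hwv
      simp only [update_self, update_of_ne huv] at he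
      omega
    · simp only [update_of_ne huv, update_of_ne hwv] at hu0 he
      exact h.pos_inj u hu w hw hu0 he
  · intro u hu hu0
    by_cases huv : u = v
    · subst huv
      refine le_trans (card_le_card fun w hw => ?_) hcard
      simp only [mem_filter, mem_range, update_self] at hw ⊢
      obtain ⟨hw, hSw, hA, hp⟩ := hw
      refine ⟨hw, hSw, ?_, hA⟩
      have h₂ := h.pos_le w hw
      by_cases hwu : w = u
      · rw [hwu, h0]
      · simp only [update_of_ne hwu] at hp
        omega
    · simp only [update_of_ne huv] at hu0
      refine le_trans (card_le_card fun w hw => ?_) (h.card_later u hu hu0)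
      simp only [mem_filter, mem_range, update_of_ne huv] at hw ⊢
      obtain ⟨hw, hSw, hA, hp⟩ := hw
      refine ⟨hw, hSw, hA, ?_⟩
      by_cases hwv : w = v
      · rw [hwv]
        exact .inl h0
      · simpa only [update_of_ne hwv] using hp
  · rcases h.progress with h' | h'
    · exact absurd h0 (h' v hv hS)
    · right
      have : #(insert v {u ∈ range L.n | L.pos u ≠ 0}) = #{u ∈ range L.n | L.pos u ≠ 0} + 1 :=
        card_insert_of_notMem fun h => (mem_filter.1 h).2 h0
      rw [← Nat.add_le_add_iff_right (n := 1), ← this] at h'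
      refine h'.trans (card_le_card fun u hu => ?_)
      rw [mem_insert, mem_filter] at hu
      rw [mem_filter, mem_range]
      by_cases huv : u = v
      · subst huv
        simp [hv]
      · simpa [update_of_ne huv] using hu.resolve_left huv

/-- This covers the idle rounds after the forest is exhausted, when only cells outside the vertex
range are written. -/
theorem Layout.Eliminated.congr {t t' : ℕ} {pos : ℕ → ℕ} (h : L.Eliminated t) (ht : t ≤ t')
    (hall : ∀ v < L.n, ¬ L.S v → L.pos v ≠ 0) (hpos : ∀ v < L.n, pos v = L.pos v) :
    ({ L with pos := pos } : Layout).Eliminated t' := by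
  constructor
  · intro v hv
    exact (hpos v hv).le.trans ((h.pos_le v hv).trans ht)
  · intro v hv hS
    exact (hpos v hv).trans (h.pos_of_mem v hv hS)
  · intro u hu v hv
    simp only [hpos u hu, hpos v hv]
    exact h.pos_inj u hu v hv
  · intro v hv hv0
    simp only [hpos v hv] at hv0 ⊢
    refine le_trans (card_le_card fun w hw => ?_) (h.card_later v hv hv0)
    simp only [mem_filter, mem_range] at hw ⊢
    rwa [hpos w hw.1] at hw
  · refine .inl fun v hv hS => ?_
    simp only [hpos v hv]
    exact hall v hv hS

/-- Every nonempty set of vertices outside of `S` contains a vertex with at most one neighbor in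
the set. -/
def Layout.Degenerate (L : Layout) : Prop :=
  ∀ U : Finset ℕ, U.Nonempty → (∀ u ∈ U, u < L.n ∧ ¬ L.S u) → ∃ v ∈ U, #{w ∈ U | L.A v w} ≤ 1

theorem Layout.Degenerate.all_of_no_candidate (hdeg : L.Degenerate)
    (hno : ¬ ∃ v < L.n, L.Candidate v) : ∀ v < L.n, ¬ L.S v → L.pos v ≠ 0 := by
  intro v hv hS h0
  obtain ⟨u, hu, hc⟩ := hdeg {w ∈ range L.n | ¬ L.S w ∧ L.pos w = 0}
    ⟨v, mem_filter.2 ⟨mem_range.2 hv, hS, h0⟩⟩ fun u hu => by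
      rw [mem_filter, mem_range] at hu
      exact ⟨hu.1, hu.2.1⟩
  rw [mem_filter, mem_range] at hu
  refine hno ⟨u, hu.1, hu.2.1, hu.2.2, le_trans (card_le_card fun w hw => ?_) hc⟩
  rw [mem_filter] at hw
  rw [mem_filter, mem_filter]
  tauto

/-- After n rounds, `progress` leaves no forest vertex without a position; `card_later` then says
that parents are unique. -/
theorem Layout.Eliminated.isForest (h : L.Eliminated L.n) (hsymm : ∀ {u v}, L.A u v → L.A v u)
    (hirr : ∀ v, ¬ L.A v v) : L.IsForest := by
  have hall : ∀ v < L.n, ¬ L.S v → L.pos v ≠ 0 := by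
    rcases h.progress with h' | h'
    · exact h'
    · intro v hv hS h0
      have : #{v ∈ range L.n | L.pos v ≠ 0} < #(range L.n) :=
        card_lt_card <| (ssubset_iff_of_subset (filter_subset _ _)).2
          ⟨v, mem_range.2 hv, by simp [h0]⟩
      rw [card_range] at this
      omega
  refine ⟨hsymm, fun hv => h.pos_of_mem _ hv, fun {u v} hu hv hSu hSv hA he => ?_,
    fun {v w w'} hv hS hw hw' => ?_, fun hv => h.pos_le _ hv⟩
  · obtain rfl := h.pos_inj u hu v hv (hall u hu hSu) he
    exact hirr u hA
  · refine card_le_one.1 (h.card_later v hv (hall v hv hS)) w ?_ w' ?_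
    · exact mem_filter.2 ⟨mem_range.2 hw.1, hw.2.1, hw.2.2.1, .inr hw.2.2.2⟩
    · exact mem_filter.2 ⟨mem_range.2 hw'.1, hw'.2.1, hw'.2.2.1, .inr hw'.2.2.2⟩

theorem Ready.exec_cEliminate (h : Ready L k b χ Δ σ) (hdeg : L.Degenerate) (h6 : ∀ v, σ 6 v = 0)
    (hsymm : ∀ {u v}, L.A u v → L.A v u) (hirr : ∀ v, ¬ L.A v v) :
    SameBut 6 σ (cEliminate.exec ρ σ) ∧
      ({ L with pos := cEliminate.exec ρ σ 6 } : Layout).IsForest := by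
  have key := Cmd.exec_upto_induction (x := 4) (m := 1)
    (p := .write 6 (.least 0 1 1 tCandidate) (.plus (.var 4) (.lit 1))) (ρ := ρ) (σ := σ)
    (fun t τ => SameBut 6 σ τ ∧ ({ L with pos := τ 6 } : Layout).Eliminated t)
    ⟨fun _ _ => rfl, by
      constructor
      · exact fun v _ => (h6 v).le
      · exact fun v _ _ => h6 v
      · exact fun u _ _ _ hu _ => absurd (h6 u) hu
      · exact fun v _ hv => absurd (h6 v) hv
      · exact .inr (Nat.zero_le _)⟩
    (by
      rintro t τ - ⟨h₁, h₂⟩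
      have h' := h.withPos h₁
      have e : (Cmd.write 6 (.least 0 1 1 tCandidate) (.plus (.var 4) (.lit 1))).exec
          (update ρ 4 t) τ = τ.write 6
            (leastBelow L.n ({ L with pos := τ 6 } : Layout).Candidate) (t + 1) := by
        rw [Cmd.exec, h'.eval_least_tCandidate]
        simp
      rw [e]
      refine ⟨h₁.write _ _, ?_⟩
      by_cases hex : ∃ v < L.n, ({ L with pos := τ 6 } : Layout).Candidate v
      · obtain ⟨h₃, h₄, -⟩ := leastBelow_spec hex
        have e6 : ∀ v, (τ.write 6 v (t + 1)) 6 = update (τ 6) v (t + 1) := fun v => by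
          simp [Store.write]
        rw [e6]
        exact h₂.step h₃ h₄
      -- The failed search returns n, and the write lands on cell n, just past the vertices.
      · rw [leastBelow_of_not_exists hex]
        exact h₂.congr (Nat.le_succ t) (Layout.Degenerate.all_of_no_candidate (L := { L with pos := τ 6 }) hdeg hex) fun v hv => by
          have : v ≠ L.n := hv.ne
          simp [Store.write_apply, this])
  rw [h.one_size] at key
  exact ⟨key.1, key.2.isForest hsymm hirr⟩

end FeedbackColoring

/-! ### Running the program -/

namespace FeedbackColoring

open RAM Finset Function
open scoped Classical

/-- Prepare the memory for the enumeration of the guesses. -/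
def cPrepare : Cmd :=
  .seq (.fill 5 0 1 (.sum 1 1 (.var 0)))
    (.seq (.write 7 (.lit 0) (.count 0 1 (tMem (.var 0))))
      (.seq (.write 7 (.lit 1) (.minus tColors (.minus tColors (.plus tCard (.lit 2)))))
        (.seq cEliminate (.write 7 (.lit 2) (.lit 1)))))

/-- The memory holds an instance, whose graph and feedback vertex set are those of `L`. -/
structure HoldsInput (L : Layout) (χ Δ : ℕ) (σ : Store) : Prop where
  size : σ 0 0 = L.n
  colors : σ 0 1 = χ
  defect : σ 0 2 = Δ
  adj : ∀ u < L.n, ∀ v < L.n, (σ 1 (u * L.n + v) ≠ 0 ↔ L.A u v)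
  mem : ∀ v < L.n, (σ 2 v ≠ 0 ↔ L.S v)
  rest : ∀ a, 3 ≤ a → ∀ i, σ a i = 0

/-- The number of colors that are tried. -/
def usedColors (χ k : ℕ) : ℕ := χ - (χ - (k + 2))

variable {L : Layout} {k χ Δ : ℕ} {σ : Store} {ρ : ℕ → ℕ}

theorem HoldsInput.exec_cPrepare (h : HoldsInput L χ Δ σ) (hdeg : L.Degenerate)
    (hsymm : ∀ {u v}, L.A u v → L.A v u) (hirr : ∀ v, ¬ L.A v v)
    (hk : #{v ∈ range L.n | L.S v} = k) :
    ∃ pos, Ready { L with pos := pos } k (usedColors χ k) χ Δ (cPrepare.exec ρ σ) ∧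
      ({ L with pos := pos } : Layout).IsForest ∧ (∀ i, cPrepare.exec ρ σ 8 i = 0) ∧
      cPrepare.exec ρ σ 7 2 = 1 := by
  set σ₁ := σ.setArray 5 L.n fun u => u * L.n with hσ₁
  set σ₂ := σ₁.write 7 0 k with hσ₂
  set σ₃ := σ₂.write 7 1 (usedColors χ k) with hσ₃
  set σ₄ := cEliminate.exec ρ σ₃ with hσ₄
  have hsize : 1 * σ 0 0 = L.n := by rw [one_mul, h.size]
  -- There is no multiplication, so u·n, needed to index the adjacency matrix, is the sum of n
  -- copies of u.
  have e₁ : (Cmd.fill 5 0 1 (.sum 1 1 (.var 0))).exec ρ σ = σ₁ := by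
    rw [hσ₁, ← hsize]
    refine Cmd.exec_fill _ fun τ hτ v hv => ?_
    simp [hτ 0 (by omega), mul_comm]
  have a₁ : ∀ a, a ≠ 5 → σ₁ a = σ a := fun a ha => Store.setArray_of_ne _ _ _ ha
  have e₂ : (Cmd.write 7 (.lit 0) (.count 0 1 (tMem (.var 0)))).exec ρ σ₁ = σ₂ := by
    have : Term.eval σ₁ (.count 0 1 (tMem (.var 0))) ρ = k := by
      rw [← hk]
      refine Term.eval_count_congr (by rw [a₁ 0 (by omega), hsize]) fun v hv => ?_
      simp only [tMem, Term.holds_cell, Term.eval_var, update_self, a₁ 2 (by omega)]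
      exact h.mem v hv
    rw [Cmd.exec, this, hσ₂, Term.eval_lit]
  have e₃ : (Cmd.write 7 (.lit 1) (.minus tColors (.minus tColors (.plus tCard (.lit 2))))).exec
      ρ σ₂ = σ₃ := by
    have h₁ : σ₂ 7 0 = k := by simp [hσ₂, Store.write_apply]
    have h₂ : σ₂ 0 1 = χ := by
      rw [hσ₂, Store.write_of_ne _ _ _ (by omega), a₁ 0 (by omega), h.colors]
    rw [Cmd.exec]
    simp only [tColors, tCard, Term.eval_minus, Term.eval_plus, Term.eval_cell, Term.eval_lit, h₁,
      h₂, hσ₃, usedColors]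
  have a₃ : ∀ a, a ≠ 5 → a ≠ 7 → σ₃ a = σ a := fun a ha ha' => by
    rw [hσ₃, Store.write_of_ne _ _ _ ha', hσ₂, Store.write_of_ne _ _ _ ha', a₁ a ha]
  have h₃ : Ready { L with pos := fun _ => 0 } k (usedColors χ k) χ Δ σ₃ := by
    constructor
    · rw [a₃ 0 (by omega) (by omega), h.size]
    · rw [a₃ 0 (by omega) (by omega), h.colors]
    · rw [a₃ 0 (by omega) (by omega), h.defect]
    · rw [a₃ 1 (by omega) (by omega)]
      exact h.adj
    · rw [a₃ 2 (by omega) (by omega)]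
      exact h.mem
    · intro u hu
      rw [hσ₃, Store.write_of_ne _ _ _ (by omega), hσ₂, Store.write_of_ne _ _ _ (by omega), hσ₁,
        Store.setArray_of_lt _ _ hu]
    · intro v _
      rw [a₃ 6 (by omega) (by omega), h.rest 6 (by omega)]
    · simp [hσ₃, hσ₂, Store.write_apply]
    · simp [hσ₃, Store.write_apply]
  obtain ⟨h₄, hF⟩ : SameBut 6 σ₃ σ₄ ∧ ({ L with pos := σ₄ 6 } : Layout).IsForest :=
    h₃.exec_cEliminate (ρ := ρ) hdeg
    (fun v => by rw [a₃ 6 (by omega) (by omega), h.rest 6 (by omega)]) hsymm hirr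
  have e : cPrepare.exec ρ σ = σ₄.write 7 2 1 := by
    rw [cPrepare, Cmd.exec, e₁, Cmd.exec, e₂, Cmd.exec, e₃]
    rfl
  rw [e]
  refine ⟨σ₄ 6, (h₃.withPos h₄).congr ?_ ?_ ?_ ?_ ?_ ?_ ?_, hF, fun i => ?_, ?_⟩
  · exact Store.write_of_ne _ _ _ (by omega)
  · exact Store.write_of_ne _ _ _ (by omega)
  · exact Store.write_of_ne _ _ _ (by omega)
  · exact Store.write_of_ne _ _ _ (by omega)
  · exact Store.write_of_ne _ _ _ (by omega)
  · simp [Store.write_apply]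
  · simp [Store.write_apply]
  · rw [Store.write_of_ne _ _ _ (by omega), h₄ 8 (by omega), a₃ 8 (by omega) (by omega),
      h.rest 8 (by omega)]
  · simp [Store.write_apply]

/-- The program. -/
def program : Prog :=
  .seq (cPrepare.compile 14 (fun _ => 0) 1)
    (.loop (.cell 7 (.lit 2)) (cStep.compile 14 (fun _ => 0) 1))

/-- The answer in the memory `τ` is correct, as far as the enumerated guesses are concerned. -/
def Answers (L : Layout) (k χ Δ : ℕ) (τ : Store) : Prop :=
  τ 3 0 = 1 ∧ L.Good χ Δ (τ 4) ∨
    τ 3 0 = 0 ∧ ∀ m < usedColors χ k ^ (2 * k), ¬ L.GoodGuess k (usedColors χ k) χ Δ m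

/-- Preparation and each guess cost polynomial time in n alone; only the number of guesses depends
on k and χ. The loop may stop early, at the first good guess. -/
theorem exists_run_program : ∃ T₁ T₂, PolyBounded T₁ ∧ PolyBounded T₂ ∧
    ∀ (L : Layout) (k χ Δ : ℕ) (σ : Store), HoldsInput L χ Δ σ → L.Degenerate →
      (∀ u v, L.A u v → L.A v u) → (∀ v, ¬ L.A v v) → #{v ∈ range L.n | L.S v} = k → 1 ≤ χ →
        ∃ t τ pos, Run program σ t τ ∧
          t ≤ T₁ L.n + (usedColors χ k ^ (2 * k) + 1) * T₂ L.n ∧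
          ({ L with pos := pos } : Layout).IsForest ∧
          Answers { L with pos := pos } k χ Δ τ := by
  obtain ⟨T₁, hT₁, h₁⟩ := cPrepare.exists_run_compile 14 (fun _ => 0) 1 (by decide) (by decide)
    (by simp [cPrepare, cEliminate, Cmd.fill, Cmd.KeepsSize]) fun _ => by decide
  obtain ⟨T₂, hT₂, h₂⟩ := cStep.exists_run_compile 14 (fun _ => 0) 1 (by decide) (by decide)
    (by simp [cStep, cPaint, cGuess, cUnused, cStatus, cExtra, cColor, cVerdict, cNext, Cmd.fill,
      Cmd.KeepsSize]) fun _ => by decide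
  refine ⟨T₁, fun n => (Expr.cell 7 (.lit 2)).cost + 1 + T₂ n, hT₁, (PolyBounded.const _).add hT₂,
    fun L k χ Δ σ h hdeg hsymm hirr hk hχ => ?_⟩
  set b := usedColors χ k with hb
  have hb0 : 0 < b := by
    rw [hb, usedColors]
    omega
  have hkn : k ≤ L.n := by
    rw [← hk]
    exact (card_filter_le _ _).trans (card_range _).le
  have hb4 : b < 4 * L.n ∨ L.n = 0 := by
    have : b ≤ k + 2 := by
      rw [hb, usedColors]
      omega
    omega
  obtain ⟨t₁, τ₁, hrun₁, ht₁, hA₁, hreg₁⟩ := h₁ σ σ (fun _ => 0) (fun _ _ => rfl)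
    (fun _ => h.rest 14 (by omega) 0)
  obtain ⟨pos, hR, hF, h8, h72⟩ :=
    h.exec_cPrepare (ρ := fun _ => 0) hdeg (fun {u v} => hsymm u v) hirr hk
  set σ₁ := cPrepare.exec (fun _ => 0) σ with hσ₁
  set L' : Layout := { L with pos := pos } with hL'
  -- While the loop goes on, `i` guesses are left and all previous ones have failed; once the flag
  -- is cleared, the answer is in place. Register 0 stays 0, as every free variable is mapped to it.
  let I : ℕ → Store → Prop := fun i τ => ∃ σ, AgreeBelow 14 σ τ ∧ τ 14 0 = 0 ∧
    Ready L' k b χ Δ σ ∧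
    ((σ 7 2 ≠ 0 ∧ ∃ m, m + i = b ^ (2 * k) ∧ i ≠ 0 ∧ σ 8 = digits b (2 * L'.n) m ∧
        ∀ m' < m, ¬ L'.GoodGuess k b χ Δ m') ∨
      (σ 7 2 = 0 ∧ Answers L' k χ Δ σ))
  have hstart : I (b ^ (2 * k)) τ₁ := by
    refine ⟨σ₁, hA₁, ?_, hR, .inl ⟨?_, 0, ?_, (pow_pos hb0 _).ne', ?_, ?_⟩⟩
    · rw [hreg₁ 0 (by decide), h.rest 14 (by omega)]
    · rw [h72]
      decide
    · exact zero_add _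
    · funext i
      simp [h8, digits]
    · exact fun m hm => absurd hm (Nat.not_lt_zero m)
  have hbody : ∀ i τ, I i τ → (Expr.cell 7 (.lit 2)).eval τ ≠ 0 → ∃ j, i = j + 1 ∧
      ∃ t τ', Run (cStep.compile 14 (fun _ => 0) 1) τ t τ' ∧ t ≤ T₂ L.n ∧ I j τ' := by
    rintro i τ ⟨σ, hA, h0, hR, hor⟩ hne
    have h7 : τ 7 = σ 7 := hA 7 (by decide)
    simp only [Expr.eval, h7] at hne
    rcases hor with ⟨-, m, hm, hi, h8, hno⟩ | ⟨h, -⟩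
    · obtain ⟨j, rfl⟩ := Nat.exists_eq_succ_of_ne_zero hi
      obtain ⟨t, τ', hrun, ht, hA', hreg⟩ := h₂ σ τ (fun _ => 0) hA (fun _ => h0)
      obtain ⟨hR', h8', hv⟩ := hR.exec_cStep (ρ := fun _ => 0) hF hb0 hb4 hkn (by omega) h8
      rw [hR.size] at ht
      refine ⟨j, rfl, t, τ', hrun, ht, _, hA', by rw [hreg 0 (by decide), h0], hR', ?_⟩
      rcases hv with ⟨h3, h72, hg⟩ | ⟨h3, hg, h72⟩
      · exact .inr ⟨h72, .inl ⟨h3, hg⟩⟩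
      · have hno' : ∀ m' < m + 1, ¬ L'.GoodGuess k b χ Δ m' := fun m' hm' => by
          rcases Nat.lt_succ_iff_lt_or_eq.1 hm' with h | rfl
          exacts [hno m' h, hg]
        by_cases hend : m + 1 = b ^ (2 * k)
        · refine .inr ⟨h72.2 hend, .inr ⟨h3, ?_⟩⟩
          rw [← hb, ← hend]
          exact hno'
        · exact .inl ⟨mt h72.1 hend, m + 1, by omega, by omega, h8', hno'⟩
    · exact absurd h hne
  obtain ⟨t₂, τ₂, hrun₂, ht₂, ⟨j, -, σ₂, hA₂, -, -, hor⟩, hend⟩ :=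
    Run.loop_of_budget hbody _ τ₁ hstart
  have h7 : τ₂ 7 = σ₂ 7 := hA₂ 7 (by decide)
  simp only [Expr.eval, h7] at hend
  refine ⟨_, τ₂, pos, .seq hrun₁ hrun₂, ?_, hF, ?_⟩
  · rw [h.size] at ht₁
    exact Nat.add_le_add ht₁ ht₂
  · rcases hor with ⟨h, -⟩ | ⟨-, h⟩
    · exact absurd hend h
    · rwa [Answers, hA₂ 3 (by decide), hA₂ 4 (by decide)]

/-- The number of guesses is bounded in terms of the size of the feedback vertex set. -/
theorem usedColors_pow_le (χ k : ℕ) : usedColors χ k ^ (2 * k) ≤ 9 * k ^ (4 * k) := by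
  have h : usedColors χ k ≤ k + 2 := by
    rw [usedColors]
    omega
  refine (Nat.pow_le_pow_left h _).trans ?_
  rcases Nat.lt_or_ge k 2 with hk | hk
  -- The factor 9 is forced by k = 1, where the bound (k + 2)^(2k) equals 9; for k = 0 the
  -- convention 0^0 = 1 is used.
  · interval_cases k <;> simp
  · calc (k + 2) ^ (2 * k) ≤ (k ^ 2) ^ (2 * k) := Nat.pow_le_pow_left (by nlinarith) _
      _ = k ^ (4 * k) := by rw [← pow_mul]; ring_nf
      _ ≤ 9 * k ^ (4 * k) := by omega

end FeedbackColoring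

/-! ### Graphs on `Fin n` -/

open Finset in
open scoped Classical in
-- The degree of a vertex inside its color class is the number of its neighbors of the same color.
theorem isDefectiveColoring_iff {V : Type*} [Fintype V] {G : SimpleGraph V} {χ Δ : ℕ}
    {f : V → Fin χ} :
    IsDefectiveColoring G Δ f ↔ ∀ v, #{w | G.Adj v w ∧ f w = f v} ≤ Δ := by
  have key : ∀ (i : Fin χ) (x : {v | f v = i}),
      (G.induce {v | f v = i}).degree x = #{w | G.Adj x w ∧ f w = f x} := by
    rintro i ⟨x, rfl⟩
    rw [← SimpleGraph.card_neighborFinset_eq_degree, ← card_map (Function.Embedding.subtype _)]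
    congr 1
    ext w
    simp
  constructor
  · intro h v
    rw [← key (f v) ⟨v, rfl⟩]
    exact (SimpleGraph.degree_le_maxDegree _ _).trans (h (f v))
  · intro h i
    refine SimpleGraph.maxDegree_le_of_forall_degree_le _ _ fun x => ?_
    rw [key]
    exact h x

/-- A finite nonempty acyclic graph has a vertex with at most one neighbor. -/
theorem SimpleGraph.IsAcyclic.exists_neighbor_unique {V : Type*} [Finite V] [Nonempty V]
    {G : SimpleGraph V} (h : G.IsAcyclic) : ∃ u, ∀ w w', G.Adj u w → G.Adj u w' → w = w' := by
  -- Take an end of a longest path: a neighbor off the path would extend it, and in an acyclic graph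
  -- a neighbor on the path can only be the second vertex.
  obtain ⟨u, v, p, hp, hmax⟩ := Walk.exists_isPath_forall_isPath_length_le_length G
  have key : ∀ w, G.Adj u w → w = p.snd := fun w hadj => by
    refine h.eq_snd_of_adj_start hp hadj ?_
    by_contra hw
    have := hmax _ _ (p.cons hadj.symm) (hp.cons hw)
    rw [Walk.length_cons] at this
    omega
  exact ⟨u, fun w w' hw hw' => (key w hw).trans (key w' hw').symm⟩

namespace FeedbackColoring

open RAM Finset Function
open scoped Classical

variable {n : ℕ}

/-- The graph and the feedback vertex set, on natural numbers. -/
def graphLayout (G : SimpleGraph (Fin n)) (S : Finset (Fin n)) : Layout where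
  n := n
  A u v := ∃ (hu : u < n) (hv : v < n), G.Adj ⟨u, hu⟩ ⟨v, hv⟩
  S v := ∃ hv : v < n, ⟨v, hv⟩ ∈ S
  pos _ := 0

theorem card_filter_range (p : ℕ → Prop) (q : Fin n → Prop) [DecidablePred p]
    [DecidablePred q] (h : ∀ v : Fin n, p v ↔ q v) :
    #{v ∈ range n | p v} = #{v : Fin n | q v} := by
  rw [← card_map Fin.valEmbedding]
  congr 1
  ext v
  simp only [mem_filter, mem_range, mem_map, mem_univ, true_and, Fin.valEmbedding_apply]
  constructor
  · exact fun ⟨hv, hp⟩ => ⟨⟨v, hv⟩, (h ⟨v, hv⟩).1 hp, rfl⟩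
  · rintro ⟨v, hq, rfl⟩
    exact ⟨v.2, (h v).2 hq⟩

variable {G : SimpleGraph (Fin n)} {S : Finset (Fin n)} {χ Δ : ℕ}

theorem graphLayout_adj {u v : Fin n} : (graphLayout G S).A u v ↔ G.Adj u v := by
  simp [graphLayout]

theorem graphLayout_mem {v : Fin n} : (graphLayout G S).S v ↔ v ∈ S := by
  simp [graphLayout]

theorem card_graphLayout : #{v ∈ range (graphLayout G S).n | (graphLayout G S).S v} = S.card := by
  refine (card_filter_range (n := n) _ (fun v => v ∈ S) fun v => graphLayout_mem).trans ?_
  simp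

theorem holdsInput_inputStore : HoldsInput (graphLayout G S) χ Δ (inputStore G χ Δ S) := by
  refine ⟨rfl, rfl, rfl, fun u hu v hv => ?_, fun v hv => ?_, fun a ha i => ?_⟩
  · have h : (∃ u' v' : Fin n, G.Adj u' v' ∧ u * n + v = (u' : ℕ) * n + v') ↔
        (graphLayout G S).A u v := by
      constructor
      · rintro ⟨u', v', hA, h⟩
        -- As both columns are below n, the index u·n + v determines the column modulo n and then
        -- the row.
        have hn : 0 < n := (Nat.zero_le _).trans_lt hv
        have hv' : v = v' := by
          have := congrArg (· % n) h
          simpa [Nat.mul_add_mod_self_right, Nat.mod_eq_of_lt (show v < n from hv),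
            Nat.mod_eq_of_lt v'.2] using this
        have hu' : u = u' := by
          subst hv'
          exact Nat.eq_of_mul_eq_mul_right hn (Nat.add_right_cancel h)
        rw [hu', hv']
        exact graphLayout_adj.2 hA
      · rintro ⟨hu, hv, hA⟩
        exact ⟨_, _, hA, rfl⟩
    rw [← h]
    exact Ne.ite_ne_right_iff one_ne_zero
  · have h : (∃ v' ∈ S, v = (v' : ℕ)) ↔ (graphLayout G S).S v := by
      constructor
      · rintro ⟨v', hS, rfl⟩
        exact ⟨v'.2, hS⟩
      · rintro ⟨hv, hS⟩
        exact ⟨_, hS, rfl⟩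
    rw [← h]
    exact Ne.ite_ne_right_iff one_ne_zero
  · match a, ha with
    | a + 3, _ => rfl

/-- A set of vertices outside `S` induces a subgraph of the forest, which is acyclic and so has a
vertex with at most one neighbor. -/
theorem graphLayout_degenerate (hS : IsFeedbackVertexSet G S) :
    (graphLayout G S).Degenerate := by
  rintro U ⟨u₀, hu₀⟩ hU
  have hle : {v : Fin n | (v : ℕ) ∈ U} ≤ {v | v ∉ S} := fun v hv hvS =>
    (hU v hv).2 (graphLayout_mem.2 hvS)
  have : Nonempty {v : Fin n | (v : ℕ) ∈ U} := ⟨⟨⟨u₀, (hU u₀ hu₀).1⟩, hu₀⟩⟩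
  obtain ⟨⟨u, hu⟩, h⟩ :=
    (SimpleGraph.IsAcyclic.embedding (G.induceHomOfLE hle) hS).exists_neighbor_unique
  refine ⟨u, hu, card_le_one.2 fun w hw w' hw' => ?_⟩
  obtain ⟨hwU, _, hw, hA⟩ := mem_filter.1 hw
  obtain ⟨hwU', _, hw', hA'⟩ := mem_filter.1 hw'
  have := h ⟨⟨w, hw⟩, hwU⟩ ⟨⟨w', hw'⟩, hwU'⟩ hA hA'
  simpa using this

/-- The colors above the size of a feedback vertex set plus two are not needed. -/
theorem exists_coloring_usedColors (hS : IsFeedbackVertexSet G S)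
    (h : AdmitsDefectiveColoring G χ Δ) :
    ∃ g : ℕ → ℕ, (∀ v < n, g v < usedColors χ S.card) ∧
      ∀ v : Fin n, #{w : Fin n | G.Adj v w ∧ g w = g v} ≤ Δ := by
  rcases Nat.lt_or_ge (S.card + 2) χ with hχ | hχ
  -- Distinct colors on `S` and two more for the forest give a proper coloring, hence one of defect
  -- 0.
  · obtain ⟨C⟩ := hS.colorable_two
    let e := S.equivFin
    let g : Fin n → ℕ := fun v => if hv : v ∈ S then e ⟨v, hv⟩ else S.card + C ⟨v, hv⟩
    have hg : ∀ v, g v < S.card + 2 := fun v => by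
      dsimp only [g]
      split_ifs with hv
      · have := (e ⟨v, hv⟩).2
        omega
      · have := (C ⟨v, hv⟩).2
        omega
    have hproper : ∀ v w, G.Adj v w → g w ≠ g v := fun v w hA he => by
      dsimp only [g] at he
      split_ifs at he with hw hv hv
      · have := e.injective (Fin.ext he)
        simp only [Subtype.mk.injEq] at this
        exact hA.ne this.symm
      · have := (e ⟨w, hw⟩).2
        omega
      · have := (e ⟨v, hv⟩).2
        omega
      · refine C.valid (v := ⟨v, hv⟩) (w := ⟨w, hw⟩) hA ?_
        exact Fin.ext (by omega)
    refine ⟨fun v => if hv : v < n then g ⟨v, hv⟩ else 0, fun v hv => ?_, fun v => ?_⟩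
    · dsimp only
      rw [dif_pos hv, usedColors]
      have := hg ⟨v, hv⟩
      omega
    · rw [card_eq_zero.2 (filter_eq_empty_iff.2 fun w _ hw => ?_)]
      · exact Nat.zero_le _
      · refine hproper v w hw.1 ?_
        simpa using hw.2
  · obtain ⟨f, hf⟩ := h
    rw [isDefectiveColoring_iff] at hf
    refine ⟨fun v => if hv : v < n then f ⟨v, hv⟩ else 0, fun v hv => ?_, fun v => ?_⟩
    · dsimp only
      rw [dif_pos hv, usedColors]
      have := (f ⟨v, hv⟩).2
      omega
    · simpa [Fin.val_inj] using hf v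

/-- A returned coloring has passed the test. If all guesses failed, `exists_goodGuess` excludes a
coloring with the reduced number of colors, and so one with χ colors. -/
theorem Answers.correct {pos : ℕ → ℕ} {τ : Store} (hS : IsFeedbackVertexSet G S) (hχ : 1 ≤ χ)
    (hF : ({ graphLayout G S with pos := pos } : Layout).IsForest)
    (h : Answers { graphLayout G S with pos := pos } S.card χ Δ τ) :
    (∃ f : Fin n → Fin (χ + 1), ReturnsColoring τ f ∧ IsDefectiveColoring G Δ f) ∨
      (ReportsNone τ ∧ ¬ AdmitsDefectiveColoring G χ Δ) := by
  have hcard : ∀ (g : ℕ → ℕ) (v : Fin n),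
      #{w ∈ range n | (graphLayout G S).A v w ∧ g w = g v} =
        #{w : Fin n | G.Adj v w ∧ g w = g v} := fun g v =>
    card_filter_range (fun w => (graphLayout G S).A v w ∧ g w = g v)
      (fun w => G.Adj v w ∧ g w = g v) fun w => and_congr_left' graphLayout_adj
  rcases h with ⟨h, hgood⟩ | ⟨h, hno⟩
  · have hle : ∀ v : Fin n, τ 4 v < χ + 1 := fun v =>
      Nat.lt_succ_of_le (not_lt.1 (hgood v v.2).1)
    refine .inl ⟨fun v => ⟨τ 4 v, hle v⟩, ⟨h, fun _ => rfl⟩, isDefectiveColoring_iff.2 fun v => ?_⟩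
    have := not_lt.1 (hgood v v.2).2
    simp only [Fin.mk.injEq]
    exact (hcard (τ 4) v).ge.trans this
  · refine .inr ⟨h, fun hadm => ?_⟩
    obtain ⟨g, hg, hd⟩ := exists_coloring_usedColors hS hadm
    have hSn : S.card ≤ n := by simpa using S.card_le_univ
    obtain ⟨m, hm, hgood⟩ := hF.exists_goodGuess (b := usedColors χ S.card) (g := g)
      (k := S.card) (χ := χ) (Δ := Δ) (by unfold usedColors; omega)
      (by
        change _ < 4 * n ∨ n = 0
        unfold usedColors
        omega)
      (Nat.sub_le _ _) (card_graphLayout (G := G)) hg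
      (fun v hv => (hcard g ⟨v, hv⟩).le.trans (hd ⟨v, hv⟩))
    exact hno m hm hgood

end FeedbackColoring

theorem corollary10 :
    ∃ (A : RAM.Prog) (c : ℕ),
      ∀ (n : ℕ) (G : SimpleGraph (Fin n)) (χ Δ : ℕ) (S : Finset (Fin n)),
        1 ≤ χ → IsFeedbackVertexSet G S →
          ∃ (t : ℕ) (τ : RAM.Store),
            RAM.Run A (inputStore G χ Δ S) t τ ∧
            t ≤ c * S.card ^ (c * S.card) * (n + 1) ^ c ∧
            ((∃ f : Fin n → Fin (χ + 1), ReturnsColoring τ f ∧ IsDefectiveColoring G Δ f) ∨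
              (ReportsNone τ ∧ ¬ AdmitsDefectiveColoring G χ Δ)) := by
  obtain ⟨T₁, T₂, hT₁, hT₂, h⟩ := FeedbackColoring.exists_run_program
  obtain ⟨C, D, hT⟩ := hT₁.add (hT₂.add hT₂)
  -- One constant dominates the coefficient 9C, the factor 4 in the exponent of k, and the degree D.
  refine ⟨FeedbackColoring.program, 9 * C + 4 + D, fun n G χ Δ S hχ hS => ?_⟩
  obtain ⟨t, τ, pos, hrun, ht, hF, hans⟩ := h (FeedbackColoring.graphLayout G S) S.card χ Δ _
    FeedbackColoring.holdsInput_inputStore (FeedbackColoring.graphLayout_degenerate hS)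
    (fun _ _ ⟨hu, hv, hA⟩ => ⟨hv, hu, hA.symm⟩) (fun _ ⟨_, _, hA⟩ => G.loopless.irrefl _ hA)
    FeedbackColoring.card_graphLayout hχ
  refine ⟨t, τ, hrun, ht.trans ?_, FeedbackColoring.Answers.correct hS hχ hF hans⟩
  set k := S.card
  set B := FeedbackColoring.usedColors χ k ^ (2 * k) with hB
  have hB₁ : 1 ≤ B := Nat.one_le_pow _ _ (by unfold FeedbackColoring.usedColors; omega)
  have hB₂ : B ≤ 9 * k ^ (4 * k) := FeedbackColoring.usedColors_pow_le χ k
  have hk : k ^ (4 * k) ≤ k ^ ((9 * C + 4 + D) * k) := by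
    rcases Nat.eq_zero_or_pos k with h0 | h0
    · rw [h0]
      simp
    · exact Nat.pow_le_pow_right h0 (Nat.mul_le_mul_right _ (by omega))
  -- Since B ≥ 1, the preparation and the one additional round are absorbed into the factor B.
  calc T₁ n + (B + 1) * T₂ n ≤ B * (T₁ n + (T₂ n + T₂ n)) := by nlinarith [Nat.zero_le (T₁ n)]
    _ ≤ (9 * k ^ (4 * k)) * (C * (n + 1) ^ D) := Nat.mul_le_mul hB₂ (hT n)
    _ = 9 * C * k ^ (4 * k) * (n + 1) ^ D := by ring
    _ ≤ (9 * C + 4 + D) * k ^ ((9 * C + 4 + D) * k) * (n + 1) ^ (9 * C + 4 + D) :=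
      Nat.mul_le_mul (Nat.mul_le_mul (by omega) hk) (Nat.pow_le_pow_right (by omega) (by omega))
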